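/- Let $K_0(\mathbf{Var}_{\mathbb C})$ be the Grothendieck ring of complex algebraic varieties: the free abelian group on the isomorphism classes $[X]$ of complex varieties (reduced separated schemes of finite type over $\mathbb C$) modulo the relations $[X]=[Y]+[X\setminus Y]$ for closed subvarieties $Y\subseteq X$, with multiplication $[X]\cdot[Y]=[X\times Y]$. The class $[X]$ is called the motive of $X$; write $q=[\mathbb C]$ for the class of the affine line. For an integer $n\ge 1$, let $\Gamma_n=\langle a,b\mid [a^n,b]=1\rangle$ be the link group of the $n$-twisted Hopf link, and let $$\mathfrak R_n(\mathrm{GL}_2)=\mathrm{Hom}(\Gamma_n,\mathrm{GL}_2(\mathbb C))=\{(A,B)\in \mathrm{GL}_2(\mathbb C)^2 \mid [A^n,B]=\mathrm{Id}\}$$ be its $\mathrm{GL}_2$-representation variety, a Zariski-closed subset of $\mathrm{GL}_2(\mathbb C)^2$ with its reduced structure. Then, for every $n\ge 1$, $$[\mathfrak R_n(\mathrm{GL}_2)]=q(q+1)(q-1)^3\left(\left\lfloor \tfrac n2\right\rfloor q^2+\left(n-\left\lfloor \tfrac n2\right\rfloor\right)q-\left\lfloor \tfrac n2\right\rfloor+1\right)\quad\text{in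 } K_0(\mathbf{Var}_{\mathbb C}).$$ -/

import Mathlib

open scoped commutatorElement
open CategoryTheory AlgebraicGeometry

attribute [local instance] Over.cartesianMonoidalCategory Over.braidedCategory

noncomputable section

namespace TwistedHopf

/-! ### Complex algebraic varieties -/

/-- A complex algebraic variety: a reduced separated scheme of finite type over `ℂ`
(not necessarily irreducible, and possibly empty). -/
structure IsVariety (X : Over (Spec (CommRingCat.of ℂ))) : Prop where
  isReduced : AlgebraicGeometry.IsReduced X.left
  isSeparated : IsSeparated X.hom
  locallyOfFiniteType : LocallyOfFiniteType X.hom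
  quasiCompact : QuasiCompact X.hom

/-- Being a complex algebraic variety, as a property of `ℂ`-schemes. -/
def varietyProperty : ObjectProperty (Over (Spec (CommRingCat.of ℂ))) := fun X => IsVariety X

/-- The category of complex algebraic varieties and regular maps: the full subcategory of the
category of `ℂ`-schemes on the varieties. -/
abbrev Variety : Type 1 := varietyProperty.FullSubcategory

/-- Points of a reduced finitely generated `ℂ`-algebra separate its elements. -/
theorem exists_point_ne_zero (A : Type*) [CommRing A] [Algebra ℂ A] [Algebra.FiniteType ℂ A]
    [_root_.IsReduced A] (a : A) (ha : a ≠ 0) : ∃ s : A →ₐ[ℂ] ℂ, s a ≠ 0 := by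
  have : IsJacobsonRing A := isJacobsonRing_of_finiteType (A := ℂ)
  have hJ : (⊥ : Ideal A).jacobson = ⊥ := by
    refine IsJacobsonRing.out ‹_› ?_
    rintro x ⟨k, hk⟩
    exact (IsNilpotent.eq_zero ⟨k, hk⟩ : x = 0)
  have hmem : a ∉ (⊥ : Ideal A).jacobson := by rw [hJ]; simpa using ha
  obtain ⟨m, ⟨-, hm⟩, ham⟩ : ∃ m : Ideal A, (⊥ ≤ m ∧ m.IsMaximal) ∧ a ∉ m := by
    by_contra! h
    exact hmem (by
      rw [Ideal.jacobson, Ideal.mem_sInf]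
      intro m hm
      exact h m hm)
  let := Ideal.Quotient.field m
  have : Module.Finite ℂ (A ⧸ m) := finite_of_finite_type_of_isJacobsonRing ℂ (A ⧸ m)
  have hb : Function.Bijective (algebraMap ℂ (A ⧸ m)) :=
    IsAlgClosed.algebraMap_bijective_of_isIntegral
  let e : ℂ ≃ₐ[ℂ] (A ⧸ m) := AlgEquiv.ofBijective (Algebra.ofId ℂ (A ⧸ m)) hb
  refine ⟨(e.symm : (A ⧸ m) →ₐ[ℂ] ℂ).comp (Ideal.Quotient.mkₐ ℂ m), ?_⟩
  simpa [Ideal.Quotient.eq_zero_iff_mem] using ham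

open TensorProduct in
/-- A tensor product over `ℂ` of reduced algebras, one of them finitely generated, is reduced. -/
theorem isReduced_tensorProduct (A B : Type*) [CommRing A] [CommRing B] [Algebra ℂ A]
    [Algebra ℂ B] [Algebra.FiniteType ℂ A] [_root_.IsReduced A] [_root_.IsReduced B] :
    _root_.IsReduced (A ⊗[ℂ] B) := by
  classical
  refine ⟨fun z hz => ?_⟩
  let b := Module.Basis.ofVectorSpace ℂ B
  let e := TensorProduct.equivFinsuppOfBasisRight (M := A) b
  apply e.injective
  rw [map_zero]
  ext i
  by_contra h
  obtain ⟨s, hs⟩ := exists_point_ne_zero A _ h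
  let φ : A ⊗[ℂ] B →ₐ[ℂ] B := Algebra.TensorProduct.lift ((Algebra.ofId ℂ B).comp s)
    (AlgHom.id ℂ B) (fun _ _ => Commute.all _ _)
  have h0 : φ z = 0 := (hz.map φ).eq_zero
  have key : ∀ w : A ⊗[ℂ] B, b.repr (φ w) i = s (e w i) := by
    intro w
    induction w with
    | zero => simp
    | add x y hx hy => simp [hx, hy]
    | tmul x y =>
      have : φ (x ⊗ₜ[ℂ] y) = s x • y := by
        simp [φ, Algebra.ofId_apply, Algebra.smul_def]
      rw [this]
      simp [e, mul_comm]
  apply hs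
  have := key z
  rw [h0] at this
  simpa using this.symm

/-- The product of two reduced affine `ℂ`-schemes, one of them of finite type, is reduced. -/
theorem isReduced_pullback_Spec {R S : CommRingCat.{0}} (f : Spec R ⟶ Spec (CommRingCat.of ℂ))
    (g : Spec S ⟶ Spec (CommRingCat.of ℂ)) [LocallyOfFiniteType f]
    [_root_.IsReduced R] [_root_.IsReduced S] :
    AlgebraicGeometry.IsReduced (Limits.pullback f g) := by
  obtain ⟨φ, rfl⟩ := Spec.map_surjective f
  obtain ⟨ψ, rfl⟩ := Spec.map_surjective g
  algebraize [φ.hom, ψ.hom]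
  have hf : φ.hom.FiniteType :=
    (HasRingHomProperty.Spec_iff (P := @LocallyOfFiniteType)).mp inferInstance
  have : Algebra.FiniteType ℂ R := hf
  have := isReduced_tensorProduct R S
  exact isReduced_of_isOpenImmersion (pullbackSpecIso ℂ R S).hom

/-- The product of two reduced `ℂ`-schemes, one of them locally of finite type, is reduced. -/
theorem isReduced_pullback {X Y : Scheme.{0}} (f : X ⟶ Spec (CommRingCat.of ℂ))
    (g : Y ⟶ Spec (CommRingCat.of ℂ)) [LocallyOfFiniteType f]
    [AlgebraicGeometry.IsReduced X] [AlgebraicGeometry.IsReduced Y] :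
    AlgebraicGeometry.IsReduced (Limits.pullback f g) := by
  apply +allowSynthFailures @IsReduced.of_openCover
    (𝒰 := Scheme.Pullback.openCoverOfLeftRight X.affineCover Y.affineCover f g)
  rintro ⟨i, j⟩
  have h1 : AlgebraicGeometry.IsReduced (X.affineCover.X i) :=
    isReduced_of_isOpenImmersion (X.affineCover.f i)
  have h2 : AlgebraicGeometry.IsReduced (Y.affineCover.X j) :=
    isReduced_of_isOpenImmersion (Y.affineCover.f j)
  have h3 := affine_isReduced_iff (R := _) |>.mp h1
  have h4 := affine_isReduced_iff (R := _) |>.mp h2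
  have h5 : LocallyOfFiniteType (X.affineCover.f i ≫ f) :=
    MorphismProperty.comp_mem _ _ _ (inferInstanceAs (LocallyOfFiniteType (X.affineCover.f i)))
      inferInstance
  exact @isReduced_pullback_Spec _ _ (X.affineCover.f i ≫ f) (Y.affineCover.f j ≫ g) h5 h3 h4

instance : varietyProperty.IsMonoidal where
  prop_unit :=
    { isReduced := by
        change AlgebraicGeometry.IsReduced (Spec (CommRingCat.of ℂ))
        infer_instance
      isSeparated := by change IsSeparated (𝟙 _); infer_instance
      locallyOfFiniteType := by change LocallyOfFiniteType (𝟙 _); infer_instance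
      quasiCompact := by change QuasiCompact (𝟙 _); infer_instance }
  prop_tensor X Y hX hY := by
    obtain ⟨_, _, _, _⟩ := hX
    obtain ⟨_, _, _, _⟩ := hY
    exact
      { isReduced := isReduced_pullback X.hom Y.hom
        isSeparated := by
          rw [Over.tensorObj_hom]; infer_instance
        locallyOfFiniteType := by
          rw [Over.tensorObj_hom]; infer_instance
        quasiCompact := by
          rw [Over.tensorObj_hom]; infer_instance }

/-- The affine variety `Spec A` of a reduced finitely generated `ℂ`-algebra `A`. -/
def affineVariety (A : Type) [CommRing A] [Algebra ℂ A] [Algebra.FiniteType ℂ A]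
    [_root_.IsReduced A] : Variety where
  obj := Over.mk (Spec.map (CommRingCat.ofHom (algebraMap ℂ A)))
  property :=
    { isReduced := inferInstanceAs (AlgebraicGeometry.IsReduced (Spec (CommRingCat.of A)))
      isSeparated := inferInstanceAs (IsSeparated (Spec.map _))
      locallyOfFiniteType := by
        change LocallyOfFiniteType (Spec.map _)
        rw [HasRingHomProperty.Spec_iff (P := @LocallyOfFiniteType)]
        simpa [RingHom.finiteType_algebraMap]
      quasiCompact := inferInstanceAs (QuasiCompact (Spec.map _)) }

/-! ### The Grothendieck ring of varieties -/

/-- The commutative monoid of isomorphism classes of varieties under the cartesian product; its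
unit is the class of a point. -/
abbrev VarietyClass : Type 1 := Skeleton Variety

/-- The element `1 • [X]` of the free abelian group on the isomorphism classes of varieties,
which is a ring with multiplication `[X] * [Y] = [X × Y]`. -/
def freeClass (X : Variety) : MonoidAlgebra ℤ VarietyClass :=
  MonoidAlgebra.of ℤ VarietyClass (toSkeleton X)

/-- The cut-and-paste elements `[X] - [Y] - [X - Y]`, for every closed subvariety `Y` of a variety
`X` (embedded by `i`) with open complement `X - Y` (embedded by `j`). -/
def scissorRelations : Set (MonoidAlgebra ℤ VarietyClass) :=
  {z | ∃ (X Y U : Variety) (i : Y ⟶ X) (j : U ⟶ X),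
    IsClosedImmersion i.hom.left ∧ IsOpenImmersion j.hom.left ∧
    Set.range j.hom.left = (Set.range i.hom.left)ᶜ ∧
    z = freeClass X - freeClass Y - freeClass U}

/-- The Grothendieck ring `K₀(Var_ℂ)`: the free abelian group on the isomorphism classes of
varieties, with multiplication given by the cartesian product, modulo the relations
`[X] = [Y] + [X - Y]`.  The product of such a relation with a class `[Z]` is again such a
relation, so the ideal that they generate is the additive subgroup that they generate. -/
abbrev GrothendieckRing : Type 1 :=
  MonoidAlgebra ℤ VarietyClass ⧸ Ideal.span scissorRelations

/-- The motive `[X] ∈ K₀(Var_ℂ)` of a variety `X`. -/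
def motive (X : Variety) : GrothendieckRing :=
  Ideal.Quotient.mk (Ideal.span scissorRelations) (freeClass X)

/-- The Lefschetz motive: the class of the affine line. -/
def lefschetz : GrothendieckRing := motive (affineVariety (Polynomial ℂ))

/-! ### Representation varieties -/

section Representation

variable (Γ : Type) [Group Γ] (r : ℕ)

/-- The matrix coefficient `ρ ↦ ρ(γ)ᵢⱼ` on the set `Hom(Γ, GL_r(ℂ))` of representations. -/
def matrixCoeff (γ : Γ) (i j : Fin r) : (Γ →* GL (Fin r) ℂ) → ℂ :=
  fun ρ => (ρ γ : Matrix (Fin r) (Fin r) ℂ) i j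

/-- The algebra of regular functions on `Hom(Γ, GL_r(ℂ))`: the algebra of complex functions
generated by all the matrix coefficients `ρ ↦ ρ(γ)ᵢⱼ`, `γ ∈ Γ`.  If `Γ` is generated by
`x₁, …, x_s`, then `ρ ↦ (ρ(x₁), …, ρ(x_s))` identifies `Hom(Γ, GL_r(ℂ))` with a Zariski-closed
subset of `GL_r(ℂ)^s`, and this is the algebra of restrictions to it of the polynomials in the
entries of the `s` matrices and of their inverses, that is, its coordinate ring
(see `repCoordinateRing_eq`). -/
def repCoordinateRing : Subalgebra ℂ ((Γ →* GL (Fin r) ℂ) → ℂ) :=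
  Algebra.adjoin ℂ {f | ∃ (γ : Γ) (i j : Fin r), f = matrixCoeff Γ r γ i j}

variable {Γ} in
/-- The coordinate ring is generated by the entries of the matrices `ρ(x)` and `ρ(x)⁻¹`, for `x`
in any generating set of `Γ`. -/
theorem repCoordinateRing_eq (S : Set Γ) (hS : Subgroup.closure S = ⊤) :
    repCoordinateRing Γ r = Algebra.adjoin ℂ {f | ∃ x ∈ S, ∃ i j : Fin r,
      f = matrixCoeff Γ r x i j ∨ f = matrixCoeff Γ r x⁻¹ i j} := by
  apply le_antisymm
  · refine Algebra.adjoin_le ?_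
    rintro _ ⟨γ, i, j, rfl⟩
    have hγ : γ ∈ Subgroup.closure S := by rw [hS]; trivial
    rw [SetLike.mem_coe]
    induction hγ using Subgroup.closure_induction'' generalizing i j with
    | mem x hx => exact Algebra.subset_adjoin ⟨x, hx, i, j, Or.inl rfl⟩
    | inv_mem x hx => exact Algebra.subset_adjoin ⟨x, hx, i, j, Or.inr rfl⟩
    | one =>
      have : matrixCoeff Γ r 1 i j = algebraMap ℂ _ ((1 : Matrix (Fin r) (Fin r) ℂ) i j) := by
        funext ρ; simp [matrixCoeff]
      rw [this]
      exact Subalgebra.algebraMap_mem _ _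
    | mul x y _ _ hx hy =>
      have : matrixCoeff Γ r (x * y) i j =
          ∑ k, matrixCoeff Γ r x i k * matrixCoeff Γ r y k j := by
        funext ρ; simp [matrixCoeff, Matrix.mul_apply]
      rw [this]
      exact Subalgebra.sum_mem _ fun k _ => Subalgebra.mul_mem _ (hx i k) (hy k j)
  · refine Algebra.adjoin_mono ?_
    rintro _ ⟨x, -, i, j, rfl | rfl⟩
    · exact ⟨x, i, j, rfl⟩
    · exact ⟨x⁻¹, i, j, rfl⟩

/-- The coordinate ring is finitely generated when `Γ` is. -/
instance [Group.FG Γ] : Algebra.FiniteType ℂ (repCoordinateRing Γ r) := by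
  obtain ⟨S, hS⟩ := (Group.FG.out : (⊤ : Subgroup Γ).FG)
  have hfin : {f : (Γ →* GL (Fin r) ℂ) → ℂ | ∃ x ∈ (S : Set Γ), ∃ i j : Fin r,
      f = matrixCoeff Γ r x i j ∨ f = matrixCoeff Γ r x⁻¹ i j}.Finite := by
    refine (Set.Finite.biUnion S.finite_toSet (t := fun x => ⋃ (i : Fin r) (j : Fin r),
      {matrixCoeff Γ r x i j, matrixCoeff Γ r x⁻¹ i j}) fun x _ => ?_).subset ?_
    · exact Set.finite_iUnion fun i => Set.finite_iUnion fun j => Set.toFinite _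
    · rintro f ⟨x, hx, i, j, h⟩
      simp only [Set.mem_iUnion]
      exact ⟨x, hx, i, j, h⟩
  rw [← Subalgebra.fg_iff_finiteType, repCoordinateRing_eq r (S : Set Γ) hS]
  exact ⟨hfin.toFinset, by rw [Set.Finite.coe_toFinset]⟩

/-- The coordinate ring is reduced. -/
instance : _root_.IsReduced (repCoordinateRing Γ r) :=
  isReduced_of_injective (repCoordinateRing Γ r).val Subtype.val_injective

/-- The `GL_r(ℂ)`-representation variety of a finitely generated group `Γ`. -/
def repVariety [Group.FG Γ] : Variety := affineVariety (repCoordinateRing Γ r)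

end Representation

/-! ### Twisted Hopf links -/

/-- The relator `[aⁿ, b]` in the free group on `a = of 0` and `b = of 1`. -/
def hopfRelator (n : ℕ) : FreeGroup (Fin 2) :=
  ⁅(FreeGroup.of 0 : FreeGroup (Fin 2)) ^ n, FreeGroup.of 1⁆

/-- The link group `Γ_n = ⟨a, b | [aⁿ, b] = 1⟩` of the `n`-twisted Hopf link. -/
abbrev HopfLinkGroup (n : ℕ) : Type := PresentedGroup {hopfRelator n}

instance (n : ℕ) : Group.FG (HopfLinkGroup n) :=
  Group.fg_of_surjective (f := PresentedGroup.mk {hopfRelator n})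
    (PresentedGroup.mk_surjective _)

/-- Representations of the link group in a group `G` are the pairs `(A, B)` of elements of `G`
with `[Aⁿ, B] = 1`. -/
def hopfRepEquiv (n : ℕ) (G : Type*) [Group G] :
    (HopfLinkGroup n →* G) ≃ {p : G × G // ⁅p.1 ^ n, p.2⁆ = 1} where
  toFun ρ := ⟨(ρ (PresentedGroup.of 0), ρ (PresentedGroup.of 1)), by
    have h : ∀ w, w = hopfRelator n → ρ (PresentedGroup.mk {hopfRelator n} w) = 1 := by
      rintro w rfl
      rw [PresentedGroup.one_of_mem (Set.mem_singleton _), map_one]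
    have h' := h ⁅FreeGroup.of 0 ^ n, FreeGroup.of 1⁆ rfl
    rwa [map_commutatorElement, map_commutatorElement, map_pow, map_pow] at h'⟩
  invFun p := PresentedGroup.toGroup (f := ![p.1.1, p.1.2]) (by
    rintro _ rfl
    simpa [hopfRelator, commutatorElement_def] using p.2)
  left_inv ρ := by
    ext i
    fin_cases i <;> simp
  right_inv p := by
    ext <;> simp

/-- The `GL_r(ℂ)`-representation variety of the `n`-twisted Hopf link. -/
def hopfRepVariety (n r : ℕ) : Variety := repVariety (HopfLinkGroup n) r

end TwistedHopf

end

/-! By Cayley–Hamilton, Aⁿ is u_n(t, d)·A plus a scalar matrix, where t and d are the trace and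
determinant of A and u_n is the Lucas polynomial. Hence AⁿB − BAⁿ = u_n(t, d)(AB − BA), and the
representation variety splits into {u_n = 0} × GL₂ and the commuting pairs with u_n ≠ 0. The latter
are all commuting pairs minus those with u_n = 0 (`cls_pairSet`).

For a condition g(t, d) = 0 on A, the commuting pairs have class [GL₂]·([`charSet g`] + [`scalarSet
g`]) (`cls_commSet`). This is the motivic form of "order of the group times number of conjugacy
classes": each characteristic polynomial carries one non-scalar class, and each scalar matrix is one
more. The matrices A alone have class q(q − 1)[`charSet g`] + q[`eigenSet g`] (`cls_matSet`). Both
follow from stratifying by vanishing entries. Every stratum has explicit coordinates, so no quotient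
by the exchange of eigenvalues is formed and nothing is inverted in K₀.

For g = u_n the eigenvalue ratio is a nontrivial n-th root of unity. Ordered pairs give n − 1
punctured lines (`cls_eigenSet_lucas`), unordered pairs give ⌊n/2⌋ of them (`cls_charSet_lucas`),
and no scalar occurs.

The scheme side is handled by rings of functions: a set is affine when its ring of regular functions
is finitely generated and all complex points of that ring are evaluations. The Nullstellensatz then
turns pointwise cutting, isomorphisms and products into identities of motives, and
`map_pull_regular` matches the coordinate ring of representations with the regular functions on
pairs of matrices. -/

namespace TwistedHopf

noncomputable section

open TensorProduct

/-! ### Motives of affine varieties -/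

section Motive

variable {A B C : Type} [CommRing A] [CommRing B] [CommRing C] [Algebra ℂ A] [Algebra ℂ B]
  [Algebra ℂ C] [Algebra.FiniteType ℂ A] [Algebra.FiniteType ℂ B] [Algebra.FiniteType ℂ C]
  [_root_.IsReduced A] [_root_.IsReduced B] [_root_.IsReduced C]

/-- The morphism of affine varieties induced by a homomorphism of algebras. -/
def affineMap (φ : A →ₐ[ℂ] B) : affineVariety B ⟶ affineVariety A :=
  ObjectProperty.homMk (Over.homMk (Spec.map (CommRingCat.ofHom φ.toRingHom)) (by
    change Spec.map _ ≫ Spec.map _ = Spec.map _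
    rw [← Spec.map_comp, ← CommRingCat.ofHom_comp]
    congr 2
    exact φ.comp_algebraMap))

/-- Isomorphic algebras define isomorphic affine varieties. -/
def affineIso (e : A ≃ₐ[ℂ] B) : affineVariety A ≅ affineVariety B where
  hom := affineMap e.symm.toAlgHom
  inv := affineMap e.toAlgHom
  hom_inv_id := by
    ext1; ext1
    change Spec.map _ ≫ Spec.map _ = 𝟙 (Spec (CommRingCat.of A))
    rw [← Spec.map_comp, ← CommRingCat.ofHom_comp, ← Spec.map_id]
    congr 1
    ext x
    exact e.symm_apply_apply x
  inv_hom_id := by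
    ext1; ext1
    change Spec.map _ ≫ Spec.map _ = 𝟙 (Spec (CommRingCat.of B))
    rw [← Spec.map_comp, ← CommRingCat.ofHom_comp, ← Spec.map_id]
    congr 1
    ext x
    exact e.apply_symm_apply x

theorem motive_congr {X Y : Variety} (e : X ≅ Y) : motive X = motive Y := by
  rw [motive, motive, freeClass, freeClass, congr_toSkeleton_of_iso e]

theorem motive_affineVariety_congr (e : A ≃ₐ[ℂ] B) :
    motive (affineVariety A) = motive (affineVariety B) :=
  motive_congr (affineIso e)

theorem motive_tensorObj (X Y : Variety) :
    motive (MonoidalCategory.tensorObj X Y) = motive X * motive Y := by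
  rw [motive, motive, motive, freeClass, Skeleton.toSkeleton_tensorObj, map_mul, map_mul]
  rfl

theorem motive_tensorUnit : motive (MonoidalCategory.tensorUnit Variety) = 1 := by
  rw [motive, freeClass, ← Skeleton.one_eq, map_one, map_one]

theorem motive_point : motive (affineVariety ℂ) = 1 := by
  rw [← motive_tensorUnit]
  have h : Spec.map (CommRingCat.ofHom (algebraMap ℂ ℂ)) = 𝟙 (Spec (CommRingCat.of ℂ)) := by
    rw [Algebra.algebraMap_self, CommRingCat.ofHom_id, Spec.map_id]
  let e : (affineVariety ℂ).obj ≅ MonoidalCategory.tensorUnit (Over (Spec (CommRingCat.of ℂ))) :=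
    Over.isoMk (Iso.refl (Spec (CommRingCat.of ℂ))) ((Category.id_comp _).trans h.symm)
  exact motive_congr (ObjectProperty.isoMk _ e)

theorem finiteType_tensorProduct (A B : Type) [CommRing A] [CommRing B] [Algebra ℂ A]
    [Algebra ℂ B] [Algebra.FiniteType ℂ A] [Algebra.FiniteType ℂ B] :
    Algebra.FiniteType ℂ (A ⊗[ℂ] B) :=
  Algebra.FiniteType.trans (S := A) inferInstance inferInstance

theorem motive_tensorProduct [Algebra.FiniteType ℂ (A ⊗[ℂ] B)] [_root_.IsReduced (A ⊗[ℂ] B)] :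
    motive (affineVariety (A ⊗[ℂ] B)) =
      motive (affineVariety A) * motive (affineVariety B) := by
  rw [← motive_tensorObj]
  refine motive_congr (ObjectProperty.isoMk _ (Over.isoMk (pullbackSpecIso ℂ A B).symm ?_))
  change (pullbackSpecIso ℂ A B).inv ≫ Limits.pullback.fst _ _ ≫ Spec.map _ = Spec.map _
  rw [pullbackSpecIso_inv_fst_assoc, ← Spec.map_comp, ← CommRingCat.ofHom_comp]

/-- Cutting an affine variety along the zero locus of a regular function. -/
theorem motive_eq_add (f : A) (φ : A →ₐ[ℂ] B) (hφ : Function.Surjective φ)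
    (hker : RingHom.ker φ = (Ideal.span {f}).radical)
    (ψ : A →ₐ[ℂ] C) (hψ : @IsLocalization.Away A _ f C _ ψ.toRingHom.toAlgebra) :
    motive (affineVariety A) = motive (affineVariety B) + motive (affineVariety C) := by
  have hi : IsClosedImmersion (affineMap φ).hom.left :=
    IsClosedImmersion.spec_of_surjective _ hφ
  have hj : IsOpenImmersion (affineMap ψ).hom.left := by
    let := ψ.toRingHom.toAlgebra
    exact IsOpenImmersion.of_isLocalization f
  have hrange : Set.range (affineMap ψ).hom.left = (Set.range (affineMap φ).hom.left)ᶜ := by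
    have h1 : Set.range (affineMap φ).hom.left =
        (PrimeSpectrum.zeroLocus {f} : Set (PrimeSpectrum A)) := by
      change Set.range (PrimeSpectrum.comap φ.toRingHom) = _
      rw [range_comap_of_surjective _ _ hφ]
      change PrimeSpectrum.zeroLocus ((RingHom.ker φ : Ideal A) : Set A) = _
      rw [hker, PrimeSpectrum.zeroLocus_radical, PrimeSpectrum.zeroLocus_span]
    have h2 : Set.range (affineMap ψ).hom.left =
        ((PrimeSpectrum.basicOpen f : TopologicalSpace.Opens (PrimeSpectrum A)) :
          Set (PrimeSpectrum A)) := by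
      let := ψ.toRingHom.toAlgebra
      exact PrimeSpectrum.localization_away_comap_range C f
    rw [h1, h2, PrimeSpectrum.basicOpen_eq_zeroLocus_compl]
    rfl
  have h : motive (affineVariety A) - motive (affineVariety B) - motive (affineVariety C) = 0 := by
    rw [motive, motive, motive, ← map_sub, ← map_sub, Ideal.Quotient.eq_zero_iff_mem]
    exact Ideal.subset_span ⟨_, _, _, affineMap φ, affineMap ψ, hi, hj, hrange, rfl⟩
  linear_combination h

end Motive

end

end TwistedHopf

namespace TwistedHopf

noncomputable section

open TensorProduct

/-! ### Rings of functions -/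

section FunctionRing

variable {X Y Z : Type}

/-- Pulling back functions along a map. -/
def pull (f : Y → X) : (X → ℂ) →ₐ[ℂ] (Y → ℂ) :=
  AlgHom.pi fun y => Pi.evalAlgHom ℂ _ (f y)

@[simp] theorem pull_apply (f : Y → X) (h : X → ℂ) (y : Y) : pull f h y = h (f y) := rfl

/-- A ring of functions on `X` is affine if it is finitely generated and each of its
complex points is the evaluation at a point of `X`. -/
structure IsAffineRing (R : Subalgebra ℂ (X → ℂ)) : Prop where
  fg : R.FG
  exists_eval : ∀ φ : R →ₐ[ℂ] ℂ, ∃ x, ∀ f : R, φ f = f.1 x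

instance (R : Subalgebra ℂ (X → ℂ)) : _root_.IsReduced R :=
  isReduced_of_injective R.val Subtype.val_injective

theorem IsAffineRing.finiteType {R : Subalgebra ℂ (X → ℂ)} (hR : IsAffineRing R) :
    Algebra.FiniteType ℂ R := R.fg_iff_finiteType.mp hR.fg

/-- Hilbert's Nullstellensatz for rings of functions. -/
theorem IsAffineRing.mem_radical {R : Subalgebra ℂ (X → ℂ)} (hR : IsAffineRing R) (f g : R)
    (h : ∀ x, f.1 x = 0 → g.1 x = 0) : g ∈ (Ideal.span {f}).radical := by
  have := hR.finiteType
  set I := (Ideal.span {f}).radical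
  have hI : I.IsRadical := Ideal.radical_isRadical _
  have : _root_.IsReduced (R ⧸ I) := by
    rwa [← Ideal.isRadical_iff_quotient_reduced]
  by_contra hg
  obtain ⟨s, hs⟩ := exists_point_ne_zero (R ⧸ I) (Ideal.Quotient.mk I g)
    (by rwa [Ne, Ideal.Quotient.eq_zero_iff_mem])
  -- A complex point of the quotient is evaluation at some x. It kills f, so f(x) = 0, yet it does
  -- not kill g.
  obtain ⟨x, hx⟩ := hR.exists_eval (s.comp (Ideal.Quotient.mkₐ ℂ I))
  have hf := hx f
  have hfI : Ideal.Quotient.mk I f = 0 :=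
    Ideal.Quotient.eq_zero_iff_mem.mpr (Ideal.le_radical (Ideal.mem_span_singleton_self f))
  simp only [AlgHom.comp_apply, Ideal.Quotient.mkₐ_eq_mk, hfI, map_zero] at hf
  exact hs ((hx g).trans (h x hf.symm))

/-- The Nullstellensatz applies vacuously to the function 1: it lies in the radical of (f), so f is
a unit of R. -/
theorem IsAffineRing.inv_mem {R : Subalgebra ℂ (X → ℂ)} (hR : IsAffineRing R) {f : X → ℂ}
    (hf : f ∈ R) (h : ∀ x, f x ≠ 0) : (fun x => (f x)⁻¹) ∈ R := by
  have h1 := hR.mem_radical ⟨f, hf⟩ 1 (fun x hx => absurd hx (h x))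
  rw [← Ideal.eq_top_iff_one, Ideal.radical_eq_top, Ideal.eq_top_iff_one,
    Ideal.mem_span_singleton] at h1
  obtain ⟨g, hg⟩ := h1
  convert g.2 using 1
  funext x
  have := congrFun (congrArg Subtype.val hg) x
  exact inv_eq_of_mul_eq_one_right this.symm

theorem IsAffineRing.prod {R : Subalgebra ℂ (X → ℂ)} {T : Subalgebra ℂ (Y → ℂ)}
    (hR : IsAffineRing R) (hT : IsAffineRing T) (a : Z → X) (b : Z → Y)
    (hab : ∀ x y, ∃ z, a z = x ∧ b z = y) :
    IsAffineRing (R.map (pull a) ⊔ T.map (pull b)) where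
  fg := (hR.fg.map _).sup (hT.fg.map _)
  exists_eval φ := by
    let Q := R.map (pull a) ⊔ T.map (pull b)
    have hl : ∀ f ∈ R, pull a f ∈ Q := fun f hf =>
      (le_sup_left : _ ≤ Q) (Subalgebra.mem_map.mpr ⟨f, hf, rfl⟩)
    have hr : ∀ f ∈ T, pull b f ∈ Q := fun f hf =>
      (le_sup_right : _ ≤ Q) (Subalgebra.mem_map.mpr ⟨f, hf, rfl⟩)
    obtain ⟨x, hx⟩ := hR.exists_eval
      (φ.comp (((pull a).comp R.val).codRestrict Q fun f => hl f f.2))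
    obtain ⟨y, hy⟩ := hT.exists_eval
      (φ.comp (((pull b).comp T.val).codRestrict Q fun f => hr f f.2))
    obtain ⟨z, rfl, rfl⟩ := hab x y
    refine ⟨z, ?_⟩
    -- The elements on which φ agrees with evaluation at z form a subalgebra, so it is enough to
    -- look at the two factors.
    have key : Q ≤ (AlgHom.equalizer φ ((Pi.evalAlgHom ℂ _ z).comp Q.val)).map Q.val := by
      refine sup_le ?_ ?_
      · rintro _ ⟨f, hf, rfl⟩
        exact ⟨⟨_, hl f hf⟩, hx ⟨f, hf⟩, rfl⟩
      · rintro _ ⟨f, hf, rfl⟩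
        exact ⟨⟨_, hr f hf⟩, hy ⟨f, hf⟩, rfl⟩
    rintro ⟨f, hf⟩
    obtain ⟨g, hg, rfl⟩ := key hf
    exact hg

end FunctionRing

/-! ### Coordinate spaces and regular functions on subsets -/

/-- A space with an affine ring of polynomial functions. -/
class CoordSpace (E : Type) where
  /-- The polynomial functions. -/
  poly : Subalgebra ℂ (E → ℂ)
  isAffineRing : IsAffineRing poly

open CoordSpace

instance : CoordSpace ℂ where
  poly := Algebra.adjoin ℂ {id}
  isAffineRing :=
    { fg := ⟨{id}, by simp⟩
      exists_eval := fun φ => by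
        refine ⟨φ ⟨id, Algebra.self_mem_adjoin_singleton ℂ _⟩, ?_⟩
        rintro ⟨f, hf⟩
        have : φ = (Pi.evalAlgHom ℂ _ (φ ⟨id, Algebra.self_mem_adjoin_singleton ℂ _⟩)).comp
            (Algebra.adjoin ℂ {id}).val := by
          apply AlgHom.adjoin_ext
          rintro x hx
          obtain rfl : x = id := hx
          rfl
        exact congrArg (· ⟨f, hf⟩) this }

instance {E F : Type} [CoordSpace E] [CoordSpace F] : CoordSpace (E × F) where
  poly := (poly (E := E)).map (pull Prod.fst) ⊔ (poly (E := F)).map (pull Prod.snd)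
  isAffineRing := isAffineRing.prod isAffineRing _ _ fun x y => ⟨(x, y), rfl, rfl⟩

variable {E F G : Type} [CoordSpace E] [CoordSpace F] [CoordSpace G]

/-- The algebra of regular functions on a subset of a coordinate space: the quotients of
polynomial functions whose denominator has no zeros on the subset. -/
def regular (S : Set E) : Subalgebra ℂ (S → ℂ) where
  carrier := {h | ∃ p ∈ poly (E := E), ∃ q ∈ poly (E := E),
    ∀ s : S, q s ≠ 0 ∧ h s = p s / q s}
  mul_mem' := by
    rintro h h' ⟨p, hp, q, hq, H⟩ ⟨p', hp', q', hq', H'⟩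
    refine ⟨p * p', mul_mem hp hp', q * q', mul_mem hq hq', fun s => ?_⟩
    refine ⟨mul_ne_zero (H s).1 (H' s).1, ?_⟩
    simp only [Pi.mul_apply, (H s).2, (H' s).2, div_mul_div_comm]
  add_mem' := by
    rintro h h' ⟨p, hp, q, hq, H⟩ ⟨p', hp', q', hq', H'⟩
    refine ⟨p * q' + q * p', add_mem (mul_mem hp hq') (mul_mem hq hp'), q * q',
      mul_mem hq hq', fun s => ?_⟩
    refine ⟨mul_ne_zero (H s).1 (H' s).1, ?_⟩
    simp only [Pi.add_apply, Pi.mul_apply, (H s).2, (H' s).2, div_add_div _ _ (H s).1 (H' s).1]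
  algebraMap_mem' c := ⟨algebraMap _ _ c, Subalgebra.algebraMap_mem _ _, 1, one_mem _,
    fun s => ⟨one_ne_zero, by simp⟩⟩

theorem poly_mem_regular (S : Set E) {p : E → ℂ} (hp : p ∈ poly (E := E)) :
    (fun s : S => p s) ∈ regular S :=
  ⟨p, hp, 1, one_mem _, fun s => ⟨one_ne_zero, by simp⟩⟩

theorem div_mem_regular {S : Set E} {f g : S → ℂ} (hf : f ∈ regular S) (hg : g ∈ regular S)
    (h : ∀ s, g s ≠ 0) : (fun s => f s / g s) ∈ regular S := by
  obtain ⟨p, hp, q, hq, H⟩ := hf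
  obtain ⟨p', hp', q', hq', H'⟩ := hg
  refine ⟨p * q', mul_mem hp hq', q * p', mul_mem hq hp', fun s => ?_⟩
  have h1 := h s
  rw [(H' s).2] at h1
  have h2 : p' s ≠ 0 := fun h0 => h1 (by simp [h0])
  refine ⟨mul_ne_zero (H s).1 h2, ?_⟩
  simp only [Pi.mul_apply, (H s).2, (H' s).2, div_div_div_eq]

theorem pull_mem_regular {S : Set E} {T : Set F} (φ : S → T)
    (hφ : ∀ p ∈ poly (E := F), (fun s => p (φ s)) ∈ regular S) {h : T → ℂ} (hh : h ∈ regular T) :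
    pull φ h ∈ regular S := by
  obtain ⟨p, hp, q, hq, H⟩ := hh
  convert div_mem_regular (hφ p hp) (hφ q hq) (fun s => (H (φ s)).1) using 1
  funext s
  exact (H (φ s)).2

/-- A subset of a coordinate space is affine if its algebra of regular functions is. -/
def IsAffine (S : Set E) : Prop := IsAffineRing (regular S)

/-- An affine ring already contains the inverses of its functions without zeros, hence all
admissible fractions of polynomials. This is how the regular functions on closed pieces, open pieces
and products are computed. -/
theorem regular_eq {S : Set E} {R : Subalgebra ℂ (S → ℂ)} (hR : IsAffineRing R)
    (h : R ≤ regular S) (hp : ∀ p ∈ poly (E := E), (fun s : S => p s) ∈ R) : regular S = R := by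
  refine le_antisymm ?_ h
  rintro f ⟨p, hpp, q, hq, H⟩
  have : f = (fun s : S => p s) * fun s : S => (q s)⁻¹ := by
    funext s
    rw [(H s).2, Pi.mul_apply, div_eq_mul_inv]
  rw [this]
  exact mul_mem (hp p hpp) (hR.inv_mem (hp q hq) fun s => (H s).1)

theorem isAffineRing_map_univ :
    IsAffineRing ((poly (E := E)).map (pull fun s : (Set.univ : Set E) => (s : E))) := by
  refine ⟨isAffineRing.fg.map _, fun φ => ?_⟩
  obtain ⟨x, hx⟩ := (isAffineRing (E := E)).exists_eval
    (φ.comp (((pull fun s : (Set.univ : Set E) => (s : E)).comp poly.val).codRestrict _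
      fun f => Subalgebra.mem_map.mpr ⟨f, f.2, rfl⟩))
  refine ⟨⟨x, trivial⟩, ?_⟩
  rintro ⟨_, f, hf, rfl⟩
  exact hx ⟨f, hf⟩

theorem regular_univ : regular (Set.univ : Set E) =
    (poly (E := E)).map (pull fun s : (Set.univ : Set E) => (s : E)) := by
  refine regular_eq isAffineRing_map_univ ?_ ?_
  · rintro _ ⟨f, hf, rfl⟩
    exact poly_mem_regular _ hf
  · intro p hp
    exact ⟨p, hp, rfl⟩

theorem isAffine_univ : IsAffine (Set.univ : Set E) := by
  rw [IsAffine, regular_univ]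
  exact isAffineRing_map_univ

/-- A map that is given by regular functions on a subset. -/
@[fun_prop]
def RegOn (S : Set E) (f : E → F) : Prop :=
  ∀ p ∈ poly (E := F), (fun s : S => p (f s)) ∈ regular S

theorem regOn_iff {S : Set E} {f : E → ℂ} : RegOn S f ↔ (fun s : S => f s) ∈ regular S := by
  refine ⟨fun h => h id (Algebra.self_mem_adjoin_singleton ℂ _), fun h p hp => ?_⟩
  have : (poly : Subalgebra ℂ (ℂ → ℂ)) ≤ (regular S).comap (pull fun s : S => f s) := by
    refine Algebra.adjoin_le ?_
    rintro _ rfl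
    exact h
  exact this hp

@[fun_prop] theorem RegOn.id (S : Set E) : RegOn S fun x => x := fun _ hp => poly_mem_regular _ hp

@[fun_prop] theorem RegOn.const (S : Set E) (c : ℂ) : RegOn S fun _ => c :=
  regOn_iff.mpr (Subalgebra.algebraMap_mem (regular S) c)

@[fun_prop] theorem RegOn.fst {S : Set E} {f : E → F × G} (h : RegOn S f) :
    RegOn S fun x => (f x).1 := fun p hp =>
  h (pull Prod.fst p) ((le_sup_left : _ ≤ (poly : Subalgebra ℂ (F × G → ℂ))) ⟨p, hp, rfl⟩)

@[fun_prop] theorem RegOn.snd {S : Set E} {f : E → F × G} (h : RegOn S f) :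
    RegOn S fun x => (f x).2 := fun p hp =>
  h (pull Prod.snd p) ((le_sup_right : _ ≤ (poly : Subalgebra ℂ (F × G → ℂ))) ⟨p, hp, rfl⟩)

@[fun_prop] theorem RegOn.prodMk {S : Set E} {f : E → F} {g : E → G} (hf : RegOn S f)
    (hg : RegOn S g) : RegOn S fun x => (f x, g x) := by
  have : (poly : Subalgebra ℂ (F × G → ℂ)) ≤
      (regular S).comap (pull fun s : S => (f s, g s)) := by
    refine sup_le ?_ ?_
    · rintro _ ⟨p, hp, rfl⟩
      exact hf p hp
    · rintro _ ⟨p, hp, rfl⟩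
      exact hg p hp
  exact fun p hp => this hp

section Arithmetic

variable {S : Set E} {f g : E → ℂ}

@[fun_prop] theorem RegOn.add (hf : RegOn S f) (hg : RegOn S g) : RegOn S fun x => f x + g x :=
  regOn_iff.mpr (add_mem (regOn_iff.mp hf) (regOn_iff.mp hg))

@[fun_prop] theorem RegOn.mul (hf : RegOn S f) (hg : RegOn S g) : RegOn S fun x => f x * g x :=
  regOn_iff.mpr (mul_mem (regOn_iff.mp hf) (regOn_iff.mp hg))

@[fun_prop] theorem RegOn.neg (hf : RegOn S f) : RegOn S fun x => -f x :=
  regOn_iff.mpr (neg_mem (regOn_iff.mp hf))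

@[fun_prop] theorem RegOn.sub (hf : RegOn S f) (hg : RegOn S g) : RegOn S fun x => f x - g x :=
  regOn_iff.mpr (sub_mem (regOn_iff.mp hf) (regOn_iff.mp hg))

@[fun_prop] theorem RegOn.pow (hf : RegOn S f) (n : ℕ) : RegOn S fun x => f x ^ n :=
  regOn_iff.mpr (pow_mem (regOn_iff.mp hf) n)

@[fun_prop] theorem RegOn.div (hf : RegOn S f) (hg : RegOn S g) (h : ∀ x ∈ S, g x ≠ 0) :
    RegOn S fun x => f x / g x :=
  regOn_iff.mpr (div_mem_regular (regOn_iff.mp hf) (regOn_iff.mp hg) fun s => h s s.2)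

end Arithmetic

theorem RegOn.mono {S T : Set E} {f : E → F} (h : RegOn T f) (hST : S ⊆ T) : RegOn S f := by
  intro p hp
  obtain ⟨a, ha, b, hb, H⟩ := h p hp
  exact ⟨a, ha, b, hb, fun s => H ⟨s, hST s.2⟩⟩

theorem regular_restrict {S T : Set E} (hST : S ⊆ T) {h : T → ℂ} (hh : h ∈ regular T) :
    pull (Set.inclusion hST) h ∈ regular S :=
  pull_mem_regular (Set.inclusion hST) (fun _ hp => poly_mem_regular S hp) hh

/-- The restriction of regular functions to a smaller subset. -/
def restrict {S T : Set E} (hST : S ⊆ T) : regular T →ₐ[ℂ] regular S :=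
  ((pull (Set.inclusion hST)).comp (regular T).val).codRestrict _
    fun f => regular_restrict hST f.2

end

end TwistedHopf

namespace TwistedHopf

noncomputable section

open TensorProduct CoordSpace

variable {E F G : Type} [CoordSpace E] [CoordSpace F] [CoordSpace G]

/-! ### Closed and open pieces of affine sets -/

section Pieces

variable {S Z U : Set E} {f : E → ℂ}

/-- A point of the restricted ring is evaluation at some x in S. Since f restricts to 0 on Z, it
vanishes at x, so x lies in Z. -/
theorem isAffineRing_map_restrict (hS : IsAffine S) (hf : RegOn S f) (hZS : Z ⊆ S)
    (hZ : ∀ x, x ∈ Z ↔ x ∈ S ∧ f x = 0) :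
    IsAffineRing ((regular S).map (pull (Set.inclusion hZS))) where
  fg := hS.fg.map _
  exists_eval φ := by
    obtain ⟨x, hx⟩ := hS.exists_eval
      (φ.comp (((pull (Set.inclusion hZS)).comp (regular S).val).codRestrict _
        fun f => Subalgebra.mem_map.mpr ⟨f, f.2, rfl⟩))
    have hfx : f x = 0 := by
      refine (hx ⟨_, regOn_iff.mp hf⟩).symm.trans (Eq.trans ?_ (map_zero φ))
      refine congrArg φ (Subtype.ext (funext fun z => ?_))
      exact ((hZ z).mp z.2).2
    refine ⟨⟨x, (hZ x).mpr ⟨x.2, hfx⟩⟩, ?_⟩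
    rintro ⟨_, g, hg, rfl⟩
    exact hx ⟨g, hg⟩

theorem map_restrict_eq (hS : IsAffine S) (hf : RegOn S f) (hZS : Z ⊆ S)
    (hZ : ∀ x, x ∈ Z ↔ x ∈ S ∧ f x = 0) :
    regular Z = (regular S).map (pull (Set.inclusion hZS)) := by
  refine regular_eq (isAffineRing_map_restrict hS hf hZS hZ) ?_ ?_
  · rintro _ ⟨g, hg, rfl⟩
    exact regular_restrict hZS hg
  · intro p hp
    exact ⟨_, poly_mem_regular S hp, rfl⟩

theorem IsAffine.zeros (hS : IsAffine S) (hf : RegOn S f)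
    (hZ : ∀ x, x ∈ Z ↔ x ∈ S ∧ f x = 0) : IsAffine Z := by
  have hZS : Z ⊆ S := fun x hx => ((hZ x).mp hx).1
  rw [IsAffine, map_restrict_eq hS hf hZS hZ]
  exact isAffineRing_map_restrict hS hf hZS hZ

/-- A point of the enlarged ring restricts to evaluation at some x in S. The relation f · f⁻¹ = 1
forces f(x) ≠ 0, so x lies in U. -/
theorem isAffineRing_sup_inv (hS : IsAffine S) (hf : RegOn S f) (hUS : U ⊆ S)
    (hU : ∀ x, x ∈ U ↔ x ∈ S ∧ f x ≠ 0) :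
    IsAffineRing ((regular S).map (pull (Set.inclusion hUS)) ⊔
      Algebra.adjoin ℂ {fun x : U => (f x)⁻¹}) where
  fg := (hS.fg.map _).sup ⟨{fun x : U => (f x)⁻¹}, by simp⟩
  exists_eval φ := by
    let Q := (regular S).map (pull (Set.inclusion hUS)) ⊔ Algebra.adjoin ℂ {fun x : U => (f x)⁻¹}
    have hl : ∀ g ∈ regular S, pull (Set.inclusion hUS) g ∈ Q := fun g hg =>
      (le_sup_left : _ ≤ Q) (Subalgebra.mem_map.mpr ⟨g, hg, rfl⟩)
    have hr : (fun x : U => (f x)⁻¹) ∈ Q :=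
      (le_sup_right : _ ≤ Q) (Algebra.self_mem_adjoin_singleton ℂ _)
    obtain ⟨x, hx⟩ := hS.exists_eval
      (φ.comp (((pull (Set.inclusion hUS)).comp (regular S).val).codRestrict Q
        fun f => hl f f.2))
    have hfx : φ ⟨_, hr⟩ * f x = 1 := by
      have h1 := hx ⟨_, regOn_iff.mp hf⟩
      change _ = f x at h1
      rw [← h1, AlgHom.comp_apply, ← map_mul, ← map_one φ]
      refine congrArg φ (Subtype.ext (funext fun z => ?_))
      exact inv_mul_cancel₀ ((hU z).mp z.2).2
    refine ⟨⟨x, (hU x).mpr ⟨x.2, right_ne_zero_of_mul_eq_one hfx⟩⟩, ?_⟩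
    set z : U := ⟨x, _⟩
    have key : Q ≤ (AlgHom.equalizer φ ((Pi.evalAlgHom ℂ _ z).comp Q.val)).map Q.val := by
      refine sup_le ?_ (Algebra.adjoin_le ?_)
      · rintro _ ⟨f, hf, rfl⟩
        exact ⟨⟨_, hl f hf⟩, hx ⟨f, hf⟩, rfl⟩
      · rintro _ rfl
        exact ⟨⟨_, hr⟩, eq_inv_of_mul_eq_one_left hfx, rfl⟩
    rintro ⟨f, hf⟩
    obtain ⟨g, hg, rfl⟩ := key hf
    exact hg

theorem sup_inv_eq (hS : IsAffine S) (hf : RegOn S f) (hUS : U ⊆ S)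
    (hU : ∀ x, x ∈ U ↔ x ∈ S ∧ f x ≠ 0) :
    regular U = (regular S).map (pull (Set.inclusion hUS)) ⊔
      Algebra.adjoin ℂ {fun x : U => (f x)⁻¹} := by
  refine regular_eq (isAffineRing_sup_inv hS hf hUS hU) (sup_le ?_ (Algebra.adjoin_le ?_)) ?_
  · rintro _ ⟨g, hg, rfl⟩
    exact regular_restrict hUS hg
  · rintro _ rfl
    have h := div_mem_regular (one_mem (regular U)) (regOn_iff.mp (hf.mono hUS))
      fun s => ((hU s).mp s.2).2
    simpa using h
  · intro p hp
    exact (le_sup_left : _ ≤ (regular S).map (pull (Set.inclusion hUS)) ⊔ _)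
      ⟨_, poly_mem_regular S hp, rfl⟩

theorem IsAffine.nonzeros (hS : IsAffine S) (hf : RegOn S f)
    (hU : ∀ x, x ∈ U ↔ x ∈ S ∧ f x ≠ 0) : IsAffine U := by
  have hUS : U ⊆ S := fun x hx => ((hU x).mp hx).1
  rw [IsAffine, sup_inv_eq hS hf hUS hU]
  exact isAffineRing_sup_inv hS hf hUS hU

theorem isLocalization_restrict (hS : IsAffine S) (hf : RegOn S f) (hUS : U ⊆ S)
    (hU : ∀ x, x ∈ U ↔ x ∈ S ∧ f x ≠ 0) :
    @IsLocalization.Away (regular S) _ ⟨_, regOn_iff.mp hf⟩ (regular U) _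
      (restrict hUS).toRingHom.toAlgebra := by
  let := (restrict hUS).toRingHom.toAlgebra
  set F : regular S := ⟨_, regOn_iff.mp hf⟩
  have hinv : (fun x : U => (f x)⁻¹) ∈ regular U := by
    rw [sup_inv_eq hS hf hUS hU]
    exact (le_sup_right : _ ≤ (regular S).map (pull (Set.inclusion hUS)) ⊔ _)
      (Algebra.self_mem_adjoin_singleton ℂ _)
  have hunit : algebraMap (regular S) (regular U) F * ⟨_, hinv⟩ = 1 :=
    Subtype.ext (funext fun z => mul_inv_cancel₀ ((hU z).mp z.2).2)
  refine IsLocalization.Away.mk _ (.of_mul_eq_one _ hunit) ?_ ?_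
  · rintro ⟨h, p, hp, q, hq, H⟩
    -- On S the denominator q vanishes only where f does, so fᵏ = q r for some k and r, and h fᵏ = p
    -- r extends to S.
    have hq' := hS.mem_radical ⟨_, poly_mem_regular S hq⟩ F fun x hx => by
      by_contra h0
      exact (H ⟨x, (hU x).mpr ⟨x.2, h0⟩⟩).1 hx
    obtain ⟨k, hk⟩ := hq'
    rw [Ideal.mem_span_singleton] at hk
    obtain ⟨r, hr⟩ := hk
    refine ⟨k, ⟨_, poly_mem_regular S hp⟩ * r, Subtype.ext (funext fun z => ?_)⟩
    have h1 : f z ^ k = q z * r.1 ⟨z, hUS z.2⟩ :=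
      congrFun (congrArg Subtype.val hr) ⟨z, hUS z.2⟩
    change h z * f z ^ k = p z * r.1 ⟨z, hUS z.2⟩
    rw [h1, (H z).2]
    field_simp [(H z).1]
  · intro a b hab
    -- The first power of f suffices: multiplied by f, both functions vanish off U, and they agree
    -- on U.
    refine ⟨1, Subtype.ext (funext fun x => ?_)⟩
    change f x ^ 1 * a.1 x = f x ^ 1 * b.1 x
    by_cases h0 : f x = 0
    · simp [h0]
    · rw [show a.1 x = b.1 x from
        congrFun (congrArg Subtype.val hab) ⟨x, (hU x).mpr ⟨x.2, h0⟩⟩]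

end Pieces

/-! ### Classes of affine sets -/

open Classical in
/-- The motive of an affine subset of a coordinate space. -/
def cls (S : Set E) : GrothendieckRing :=
  if h : IsAffine S then
    haveI := h.finiteType
    motive (affineVariety (regular S))
  else 0

theorem cls_eq_motive {S : Set E} (h : IsAffine S) [Algebra.FiniteType ℂ (regular S)] :
    cls S = motive (affineVariety (regular S)) := by
  rw [cls, dif_pos h]

/-- Cutting an affine set along the zeros of a regular function. -/
theorem cls_eq_add {S Z U : Set E} {f : E → ℂ} (hS : IsAffine S) (hf : RegOn S f)
    (hZ : ∀ x, x ∈ Z ↔ x ∈ S ∧ f x = 0) (hU : ∀ x, x ∈ U ↔ x ∈ S ∧ f x ≠ 0) :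
    cls S = cls Z + cls U := by
  have hZS : Z ⊆ S := fun x hx => ((hZ x).mp hx).1
  have hUS : U ⊆ S := fun x hx => ((hU x).mp hx).1
  have hZa := hS.zeros hf hZ
  have hUa := hS.nonzeros hf hU
  have := hS.finiteType
  have := hZa.finiteType
  have := hUa.finiteType
  rw [cls_eq_motive hS, cls_eq_motive hZa, cls_eq_motive hUa]
  refine motive_eq_add ⟨_, regOn_iff.mp hf⟩ (restrict hZS) ?_ ?_ (restrict hUS)
    (isLocalization_restrict hS hf hUS hU)
  · rintro ⟨g, hg⟩
    have hg' := hg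
    rw [map_restrict_eq hS hf hZS hZ] at hg'
    obtain ⟨h, hh, rfl⟩ := hg'
    exact ⟨⟨h, hh⟩, rfl⟩
  -- The functions vanishing on Z lie in the radical by the Nullstellensatz; conversely the kernel
  -- is radical because `regular Z` is reduced.
  · apply le_antisymm
    · intro g hg
      refine hS.mem_radical _ g fun x hx => ?_
      exact congrFun (congrArg Subtype.val hg) ⟨x, (hZ x).mpr ⟨x.2, hx⟩⟩
    · refine (Ideal.IsRadical.radical_le_iff ?_).mpr ?_
      · rintro a ⟨k, hk⟩
        rw [RingHom.mem_ker, map_pow] at hk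
        exact IsNilpotent.eq_zero ⟨k, hk⟩
      rw [Ideal.span_singleton_le_iff_mem]
      exact Subtype.ext (funext fun z => ((hZ z).mp z.2).2)

/-- An isomorphism between subsets of coordinate spaces. -/
structure RegIso (S : Set E) (T : Set F) where
  /-- The map. -/
  toFun : E → F
  /-- The inverse map. -/
  invFun : F → E
  mapsTo : ∀ x ∈ S, toFun x ∈ T
  mapsTo_inv : ∀ y ∈ T, invFun y ∈ S
  left_inv : ∀ x ∈ S, invFun (toFun x) = x
  right_inv : ∀ y ∈ T, toFun (invFun y) = y
  regOn : RegOn S toFun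
  regOn_inv : RegOn T invFun

namespace RegIso

variable {S : Set E} {T : Set F}

/-- The inverse of an isomorphism. -/
def symm (e : RegIso S T) : RegIso T S :=
  ⟨e.invFun, e.toFun, e.mapsTo_inv, e.mapsTo, e.right_inv, e.left_inv, e.regOn_inv, e.regOn⟩

/-- The homomorphism between algebras of regular functions. -/
def pullback (e : RegIso S T) : regular T →ₐ[ℂ] regular S :=
  ((pull fun s : S => (⟨e.toFun s, e.mapsTo s s.2⟩ : T)).comp (regular T).val).codRestrict _
    fun f => pull_mem_regular (fun s : S => (⟨e.toFun s, e.mapsTo s s.2⟩ : T)) e.regOn f.2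

/-- The isomorphism between algebras of regular functions. -/
def algEquiv (e : RegIso S T) : regular T ≃ₐ[ℂ] regular S :=
  AlgEquiv.ofAlgHom e.pullback e.symm.pullback
    (AlgHom.ext fun f => Subtype.ext (funext fun s =>
      congrArg f.1 (Subtype.ext (e.left_inv s s.2))))
    (AlgHom.ext fun f => Subtype.ext (funext fun s =>
      congrArg f.1 (Subtype.ext (e.right_inv s s.2))))

theorem isAffine (e : RegIso S T) (h : IsAffine S) : IsAffine T where
  fg := by
    have := h.finiteType
    exact (Subalgebra.fg_iff_finiteType _).mpr (Algebra.FiniteType.equiv this e.algEquiv.symm)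
  exists_eval φ := by
    obtain ⟨x, hx⟩ := h.exists_eval (φ.comp e.algEquiv.symm.toAlgHom)
    refine ⟨⟨e.toFun x, e.mapsTo x x.2⟩, fun f => ?_⟩
    have := hx (e.algEquiv f)
    rw [AlgHom.comp_apply] at this
    exact (congrArg φ (e.algEquiv.symm_apply_apply f)).symm.trans this

/-- No affineness is assumed: it passes both ways along e, and if it fails for both sets then both
classes are the default 0. -/
theorem cls_eq (e : RegIso S T) : cls S = cls T := by
  by_cases h : IsAffine S
  · have h' := e.isAffine h
    have := h.finiteType
    have := h'.finiteType
    rw [cls_eq_motive h, cls_eq_motive h', motive_affineVariety_congr e.algEquiv]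
  · have h' : ¬ IsAffine T := fun h' => h (e.symm.isAffine h')
    rw [cls, cls, dif_neg h, dif_neg h']

end RegIso

/-! ### Products of affine sets -/

section Product

variable {S : Set E} {T : Set F}

theorem isAffineRing_prod (hS : IsAffine S) (hT : IsAffine T) :
    IsAffineRing ((regular S).map (pull fun x : ↥(S ×ˢ T) => ⟨x.1.1, x.2.1⟩) ⊔
      (regular T).map (pull fun x : ↥(S ×ˢ T) => ⟨x.1.2, x.2.2⟩)) :=
  IsAffineRing.prod hS hT _ _ fun x y => ⟨⟨(x, y), x.2, y.2⟩, rfl, rfl⟩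

theorem regular_prod (hS : IsAffine S) (hT : IsAffine T) :
    regular (S ×ˢ T) = (regular S).map (pull fun x : ↥(S ×ˢ T) => ⟨x.1.1, x.2.1⟩) ⊔
      (regular T).map (pull fun x : ↥(S ×ˢ T) => ⟨x.1.2, x.2.2⟩) := by
  refine regular_eq (isAffineRing_prod hS hT) (sup_le ?_ ?_) ?_
  · rintro _ ⟨f, hf, rfl⟩
    exact pull_mem_regular (fun x : ↥(S ×ˢ T) => ⟨x.1.1, x.2.1⟩) (RegOn.id (S ×ˢ T)).fst hf
  · rintro _ ⟨f, hf, rfl⟩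
    exact pull_mem_regular (fun x : ↥(S ×ˢ T) => ⟨x.1.2, x.2.2⟩) (RegOn.id (S ×ˢ T)).snd hf
  · intro p hp
    have : (poly : Subalgebra ℂ (E × F → ℂ)) ≤
        Subalgebra.comap (pull fun x : ↥(S ×ˢ T) => x.1)
          ((regular S).map (pull fun x : ↥(S ×ˢ T) => ⟨x.1.1, x.2.1⟩) ⊔
            (regular T).map (pull fun x : ↥(S ×ˢ T) => ⟨x.1.2, x.2.2⟩)) := by
      refine sup_le ?_ ?_
      · rintro _ ⟨f, hf, rfl⟩
        exact Algebra.mem_sup_left ⟨_, poly_mem_regular S hf, rfl⟩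
      · rintro _ ⟨f, hf, rfl⟩
        exact Algebra.mem_sup_right ⟨_, poly_mem_regular T hf, rfl⟩
    exact this hp

theorem IsAffine.prod (hS : IsAffine S) (hT : IsAffine T) : IsAffine (S ×ˢ T) := by
  rw [IsAffine, regular_prod hS hT]
  exact isAffineRing_prod hS hT

/-- The tensor product is reduced and finitely generated, so a nonzero element survives at some
complex point. Such a point is a pair of points of A and B, which `h` realizes by evaluation at a
single x in X. -/
theorem productMap_injective {A B : Type} {X : Type} [CommRing A] [CommRing B] [Algebra ℂ A]
    [Algebra ℂ B] [Algebra.FiniteType ℂ A] [Algebra.FiniteType ℂ B] [_root_.IsReduced A]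
    [_root_.IsReduced B] (a : A →ₐ[ℂ] (X → ℂ)) (b : B →ₐ[ℂ] (X → ℂ))
    (h : ∀ (φ : A →ₐ[ℂ] ℂ) (ψ : B →ₐ[ℂ] ℂ), ∃ x, (∀ f, φ f = a f x) ∧ ∀ g, ψ g = b g x) :
    Function.Injective (Algebra.TensorProduct.productMap a b) := by
  have := isReduced_tensorProduct A B
  have := finiteType_tensorProduct A B
  rw [injective_iff_map_eq_zero]
  intro z hz
  by_contra h0
  obtain ⟨χ, hχ⟩ := exists_point_ne_zero _ z h0
  obtain ⟨x, h1, h2⟩ := h (χ.comp Algebra.TensorProduct.includeLeft)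
    (χ.comp Algebra.TensorProduct.includeRight)
  have key : χ = (Pi.evalAlgHom ℂ _ x).comp (Algebra.TensorProduct.productMap a b) := by
    refine Algebra.TensorProduct.ext (AlgHom.ext fun f => ?_) (AlgHom.ext fun f => ?_)
    · rw [h1]
      simp
    · refine (h2 f).trans ?_
      simp
  apply hχ
  rw [key, AlgHom.comp_apply, hz]
  rfl

theorem motive_of_productMap {A B : Type} {X : Type} [CommRing A] [CommRing B] [Algebra ℂ A]
    [Algebra ℂ B] [Algebra.FiniteType ℂ A] [Algebra.FiniteType ℂ B] [_root_.IsReduced A]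
    [_root_.IsReduced B] (a : A →ₐ[ℂ] (X → ℂ)) (b : B →ₐ[ℂ] (X → ℂ))
    (h : ∀ (φ : A →ₐ[ℂ] ℂ) (ψ : B →ₐ[ℂ] ℂ), ∃ x, (∀ f, φ f = a f x) ∧ ∀ g, ψ g = b g x)
    (R : Subalgebra ℂ (X → ℂ)) [Algebra.FiniteType ℂ R] (hR : R = a.range ⊔ b.range) :
    motive (affineVariety R) = motive (affineVariety A) * motive (affineVariety B) := by
  have := isReduced_tensorProduct A B
  have := finiteType_tensorProduct A B
  rw [← motive_tensorProduct]
  refine motive_affineVariety_congr ((AlgEquiv.ofInjective _ (productMap_injective a b h)).trans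
    (Subalgebra.equivOfEq _ _ ?_)).symm
  rw [Algebra.TensorProduct.productMap_range, hR]

theorem cls_prod (hS : IsAffine S) (hT : IsAffine T) : cls (S ×ˢ T) = cls S * cls T := by
  have := hS.finiteType
  have := hT.finiteType
  have := (hS.prod hT).finiteType
  rw [cls_eq_motive hS, cls_eq_motive hT, cls_eq_motive (hS.prod hT)]
  refine motive_of_productMap
    ((pull fun x : ↥(S ×ˢ T) => (⟨x.1.1, x.2.1⟩ : S)).comp (regular S).val)
    ((pull fun x : ↥(S ×ˢ T) => (⟨x.1.2, x.2.2⟩ : T)).comp (regular T).val) ?_ _ ?_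
  · intro φ ψ
    obtain ⟨x, hx⟩ := hS.exists_eval φ
    obtain ⟨y, hy⟩ := hT.exists_eval ψ
    exact ⟨⟨(x, y), x.2, y.2⟩, hx, hy⟩
  · rw [regular_prod hS hT, AlgHom.range_comp, AlgHom.range_comp, Subalgebra.range_val,
      Subalgebra.range_val]

end Product

/-! ### The line, points and finite decompositions -/

theorem cls_univ_complex : cls (Set.univ : Set ℂ) = lefschetz := by
  have hA : IsAffine (Set.univ : Set ℂ) := isAffine_univ
  have := hA.finiteType
  rw [cls_eq_motive hA, lefschetz]
  let φ : Polynomial ℂ →ₐ[ℂ] (↥(Set.univ : Set ℂ) → ℂ) :=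
    Polynomial.aeval fun x : ↥(Set.univ : Set ℂ) => (x : ℂ)
  have hφ : ∀ p x, φ p x = p.eval x.1 := fun p x => by
    rw [← Pi.evalAlgHom_apply ℂ (fun _ : ↥(Set.univ : Set ℂ) => ℂ) x (φ p), ← AlgHom.comp_apply,
      ← Polynomial.coe_aeval_eq_eval]
    refine congrArg (fun χ : Polynomial ℂ →ₐ[ℂ] ℂ => χ p) (Polynomial.algHom_ext ?_)
    simp [φ]
  have hinj : Function.Injective φ := by
    intro p q hpq
    refine Polynomial.funext fun x => ?_
    have := congrFun hpq ⟨x, trivial⟩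
    rwa [hφ, hφ] at this
  have hrange : φ.range = regular (Set.univ : Set ℂ) := by
    rw [regular_univ, ← Algebra.adjoin_singleton_eq_range_aeval]
    change _ = (Algebra.adjoin ℂ {id}).map _
    rw [AlgHom.map_adjoin_singleton]
    rfl
  exact motive_affineVariety_congr
    ((AlgEquiv.ofInjective _ hinj).trans (Subalgebra.equivOfEq _ _ hrange)).symm

theorem cls_empty : cls (∅ : Set E) = 0 := by
  have hU : IsAffine (∅ : Set E) :=
    isAffine_univ.nonzeros (RegOn.const _ 0) fun x => by simp
  -- Cutting ∅ into ∅ and ∅ gives c = c + c.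
  have := cls_eq_add hU (RegOn.const _ 0) (Z := ∅) (U := ∅) (by simp) (by simp)
  simpa using this

theorem cls_singleton_complex (c : ℂ) : cls ({c} : Set ℂ) = 1 := by
  have hA : IsAffine ({c} : Set ℂ) :=
    isAffine_univ.zeros (f := fun x => x - c) (by fun_prop) fun x => by simp [sub_eq_zero]
  have := hA.finiteType
  rw [cls_eq_motive hA, ← motive_point]
  refine motive_affineVariety_congr (AlgEquiv.ofBijective (Algebra.ofId ℂ _) ⟨?_, ?_⟩).symm
  · intro a b hab
    exact congrFun (congrArg Subtype.val hab) ⟨c, rfl⟩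
  · intro f
    refine ⟨f.1 ⟨c, rfl⟩, Subtype.ext (funext ?_)⟩
    rintro ⟨_, rfl⟩
    rfl

theorem isAffine_nonzero : IsAffine {x : ℂ | x ≠ 0} :=
  isAffine_univ.nonzeros (f := fun x => x) (by fun_prop) fun x => by simp

theorem cls_nonzero : cls {x : ℂ | x ≠ 0} = lefschetz - 1 := by
  have := cls_eq_add isAffine_univ (f := fun x : ℂ => x) (by fun_prop) (Z := {0})
    (U := {x | x ≠ 0}) (by simp) (by simp)
  rw [cls_univ_complex, cls_singleton_complex] at this
  linear_combination -this

/-- Decomposing an affine set by the values of a regular function with finitely many values. -/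
theorem cls_eq_sum {S : Set E} {f : E → ℂ} (W : Finset ℂ) (hS : IsAffine S) (hf : RegOn S f)
    (hW : ∀ x ∈ S, f x ∈ W) : cls S = ∑ w ∈ W, cls {x | x ∈ S ∧ f x = w} := by
  induction W using Finset.induction_on generalizing S with
  | empty =>
    have : S = ∅ := Set.eq_empty_of_forall_notMem fun x hx => by simpa using hW x hx
    rw [this, cls_empty, Finset.sum_empty]
  | insert a W ha ih =>
    have hfa : RegOn S fun x => f x - a := by fun_prop
    have hU : ∀ x, x ∈ {x | x ∈ S ∧ f x ≠ a} ↔ x ∈ S ∧ f x - a ≠ 0 := fun x => by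
      simp [sub_eq_zero]
    rw [cls_eq_add hS hfa (Z := {x | x ∈ S ∧ f x = a}) (fun x => by simp [sub_eq_zero]) hU,
      Finset.sum_insert ha, ih (hS.nonzeros hfa hU) (hf.mono fun x hx => hx.1)]
    · congr 1
      refine Finset.sum_congr rfl fun w hw => congrArg cls ?_
      ext x
      have : w ≠ a := fun h => ha (h ▸ hw)
      simp only [Set.mem_ofPred_eq]
      constructor
      · exact fun h => ⟨h.1.1, h.2⟩
      · rintro ⟨h1, rfl⟩
        exact ⟨⟨h1, this⟩, rfl⟩
    · intro x hx
      exact (Finset.mem_insert.mp (hW x hx.1)).resolve_left hx.2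

end

end TwistedHopf

namespace TwistedHopf

noncomputable section

variable {E F G : Type} [CoordSpace E] [CoordSpace F] [CoordSpace G]

theorem RegOn.comp_univ {S : Set E} {g : F → G} (hg : RegOn Set.univ g) {f : E → F}
    (hf : RegOn S f) : RegOn S fun x => g (f x) := fun p hp =>
  pull_mem_regular (fun s : S => (⟨f s, trivial⟩ : (Set.univ : Set F))) hf (hg p hp)

/-! ### Sets cut out by equations and inequations -/

section AffineConditions

variable {f g : E → ℂ} {p : E → Prop}

theorem isAffine_eq_and (hf : RegOn Set.univ f) (hg : RegOn Set.univ g) (hp : IsAffine {x | p x}) :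
    IsAffine {x | f x = g x ∧ p x} :=
  hp.zeros ((hf.sub hg).mono (Set.subset_univ _)) fun x => by simp [sub_eq_zero, and_comm]

theorem isAffine_ne_and (hf : RegOn Set.univ f) (hg : RegOn Set.univ g) (hp : IsAffine {x | p x}) :
    IsAffine {x | f x ≠ g x ∧ p x} :=
  hp.nonzeros ((hf.sub hg).mono (Set.subset_univ _)) fun x => by simp [sub_eq_zero, and_comm]

theorem isAffine_eq (hf : RegOn Set.univ f) (hg : RegOn Set.univ g) :
    IsAffine {x | f x = g x} :=
  isAffine_univ.zeros (hf.sub hg) fun x => by simp [sub_eq_zero]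

end AffineConditions

/-! ### Matrices with constrained characteristic polynomial -/

/-- The space of `2 × 2` matrices `(a, b; c, d)`. -/
abbrev Mat : Type := ℂ × ℂ × ℂ × ℂ

/-- The trace and the determinant. -/
def charPair (A : Mat) : ℂ × ℂ := (A.1 + A.2.2.2, A.1 * A.2.2.2 - A.2.1 * A.2.2.1)

@[fun_prop] theorem RegOn.charPair {S : Set E} {f : E → Mat} (hf : RegOn S f) :
    RegOn S fun x => charPair (f x) := by
  unfold TwistedHopf.charPair
  fun_prop

/-- The pairs `(t, d)` with `d ≠ 0` and `g(t, d) = 0`. -/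
def charSet (g : ℂ × ℂ → ℂ) : Set (ℂ × ℂ) := {p | p.2 ≠ 0 ∧ g p = 0}

/-- The pairs of nonzero eigenvalues of a matrix whose trace and determinant satisfy `g = 0`. -/
def eigenSet (g : ℂ × ℂ → ℂ) : Set (ℂ × ℂ) :=
  {p | p.1 ≠ 0 ∧ p.2 ≠ 0 ∧ g (p.1 + p.2, p.1 * p.2) = 0}

/-- The pairs of distinct nonzero eigenvalues of a matrix whose trace and determinant
satisfy `g = 0`. -/
def distinctEigenSet (g : ℂ × ℂ → ℂ) : Set (ℂ × ℂ) :=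
  {p | p.1 ≠ p.2 ∧ p.1 ≠ 0 ∧ p.2 ≠ 0 ∧ g (p.1 + p.2, p.1 * p.2) = 0}

/-- The nonzero scalars whose trace and determinant satisfy `g = 0`. -/
def scalarSet (g : ℂ × ℂ → ℂ) : Set ℂ := {a | a ≠ 0 ∧ g (a + a, a * a) = 0}

/-- The invertible matrices whose trace and determinant satisfy `g = 0`. -/
def matSet (g : ℂ × ℂ → ℂ) : Set Mat := {A | (charPair A).2 ≠ 0 ∧ g (charPair A) = 0}

/-- The condition that two matrices commute. -/
def Commutes (A B : Mat) : Prop :=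
  A.2.1 * B.2.2.1 = A.2.2.1 * B.2.1 ∧
    (A.1 - A.2.2.2) * B.2.1 = A.2.1 * (B.1 - B.2.2.2) ∧
    (A.1 - A.2.2.2) * B.2.2.1 = A.2.2.1 * (B.1 - B.2.2.2)

/-- The commuting pairs of invertible matrices, the trace and the determinant of the first
satisfying `g = 0`. -/
def commSet (g : ℂ × ℂ → ℂ) : Set (Mat × Mat) :=
  {x | (charPair x.1).2 ≠ 0 ∧ g (charPair x.1) = 0 ∧ (charPair x.2).2 ≠ 0 ∧ Commutes x.1 x.2}

variable {g : ℂ × ℂ → ℂ} (hg : RegOn Set.univ g)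

include hg

theorem isAffine_charSet : IsAffine (charSet g) := by
  unfold charSet
  refine isAffine_ne_and ?_ ?_ (isAffine_eq ?_ ?_) <;> fun_prop

theorem isAffine_eigenSet : IsAffine (eigenSet g) := by
  unfold eigenSet
  refine isAffine_ne_and ?_ ?_ (isAffine_ne_and ?_ ?_ (isAffine_eq (hg.comp_univ ?_) ?_)) <;>
    fun_prop

theorem isAffine_distinctEigenSet : IsAffine (distinctEigenSet g) :=
  isAffine_ne_and (by fun_prop) (by fun_prop) (isAffine_eigenSet hg)

theorem isAffine_scalarSet : IsAffine (scalarSet g) := by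
  unfold scalarSet
  refine isAffine_ne_and ?_ ?_ (isAffine_eq (hg.comp_univ ?_) ?_) <;> fun_prop

theorem isAffine_matSet : IsAffine (matSet g) := by
  unfold matSet
  refine isAffine_ne_and ?_ ?_ (isAffine_eq (hg.comp_univ ?_) ?_) <;> fun_prop

theorem isAffine_commSet : IsAffine (commSet g) := by
  unfold commSet Commutes
  refine isAffine_ne_and ?_ ?_ (isAffine_eq_and (hg.comp_univ ?_) ?_ (isAffine_ne_and ?_ ?_
    (isAffine_eq_and ?_ ?_ (isAffine_eq_and ?_ ?_ (isAffine_eq ?_ ?_))))) <;> fun_prop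

theorem cls_eigenSet : cls (eigenSet g) = cls (distinctEigenSet g) + cls (scalarSet g) := by
  have h := cls_eq_add (isAffine_eigenSet hg) (f := fun p => p.1 - p.2) (by fun_prop)
    (Z := {p | p ∈ eigenSet g ∧ p.1 = p.2}) (U := distinctEigenSet g)
    (by simp [sub_eq_zero]) (by simp [sub_eq_zero, distinctEigenSet, eigenSet, and_comm])
  let e : RegIso {p | p ∈ eigenSet g ∧ p.1 = p.2} (scalarSet g) :=
    { toFun := fun p => p.1
      invFun := fun a => (a, a)
      mapsTo := by
        rintro ⟨a, b⟩ ⟨⟨h1, h2, h3⟩, rfl : a = b⟩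
        exact ⟨h1, h3⟩
      mapsTo_inv := fun a ha => ⟨⟨ha.1, ha.1, ha.2⟩, rfl⟩
      left_inv := by
        rintro ⟨a, b⟩ ⟨-, rfl : a = b⟩
        rfl
      right_inv := fun a _ => rfl
      regOn := by fun_prop
      regOn_inv := by fun_prop }
  rw [h, e.cls_eq, add_comm]

/-- Where b ≠ 0, the trace, the determinant, a and b are coordinates, since the determinant
determines c. Where b = 0, the matrix is lower triangular: its diagonal is an ordered pair of
eigenvalues and c is free. -/
theorem cls_matSet : cls (matSet g) =
    lefschetz * (lefschetz - 1) * cls (charSet g) + lefschetz * cls (eigenSet g) := by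
  rw [cls_eq_add (isAffine_matSet hg) (f := fun A => A.2.1) (by fun_prop)
    (Z := {A | A ∈ matSet g ∧ A.2.1 = 0}) (U := {A | A ∈ matSet g ∧ A.2.1 ≠ 0})
    (fun _ => Iff.rfl) (fun _ => Iff.rfl)]
  let e : RegIso {A | A ∈ matSet g ∧ A.2.1 = 0} (eigenSet g ×ˢ (Set.univ : Set ℂ)) :=
    { toFun := fun A => ((A.1, A.2.2.2), A.2.2.1)
      invFun := fun x => (x.1.1, 0, x.2, x.1.2)
      mapsTo := by
        rintro ⟨a, b, c, d⟩ ⟨⟨h1, h2⟩, rfl : b = 0⟩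
        simp_all [charPair, eigenSet]
      mapsTo_inv := by
        rintro ⟨⟨a, d⟩, c⟩ h
        simp_all [charPair, eigenSet, matSet]
      left_inv := by
        rintro ⟨a, b, c, d⟩ ⟨-, rfl : b = 0⟩
        rfl
      right_inv := fun _ _ => rfl
      regOn := by fun_prop
      regOn_inv := by fun_prop }
  let e' : RegIso {A | A ∈ matSet g ∧ A.2.1 ≠ 0}
      (charSet g ×ˢ ((Set.univ : Set ℂ) ×ˢ {b : ℂ | b ≠ 0})) :=
    { toFun := fun A => (charPair A, A.1, A.2.1)
      invFun := fun x => (x.2.1, x.2.2,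
        (x.2.1 * (x.1.1 - x.2.1) - x.1.2) / x.2.2, x.1.1 - x.2.1)
      mapsTo := fun A hA => ⟨hA.1, trivial, hA.2⟩
      mapsTo_inv := by
        rintro ⟨⟨t, d⟩, a, b⟩ ⟨h1, -, h2 : b ≠ 0⟩
        refine ⟨?_, h2⟩
        change TwistedHopf.charPair _ ∈ charSet g
        convert h1 using 1
        simp only [charPair, Prod.mk.injEq]
        constructor
        · ring
        · field_simp
          ring
      left_inv := by
        rintro ⟨a, b, c, d⟩ ⟨-, h2 : b ≠ 0⟩
        simp only [charPair, Prod.mk.injEq]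
        refine ⟨trivial, trivial, ?_, ?_⟩
        · field_simp
          ring
        · ring
      right_inv := by
        rintro ⟨⟨t, d⟩, a, b⟩ ⟨-, -, h2 : b ≠ 0⟩
        simp only [charPair, Prod.mk.injEq]
        refine ⟨⟨?_, ?_⟩, trivial⟩
        · ring
        · field_simp
          ring
      regOn := by fun_prop
      regOn_inv := by
        have := fun x (hx : x ∈ charSet g ×ˢ ((Set.univ : Set ℂ) ×ˢ {b : ℂ | b ≠ 0})) => hx.2.2
        fun_prop (disch := assumption) }
  rw [e.cls_eq, e'.cls_eq, cls_prod (isAffine_eigenSet hg) isAffine_univ,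
    cls_prod (isAffine_charSet hg) (isAffine_univ.prod isAffine_nonzero),
    cls_prod isAffine_univ isAffine_nonzero, cls_univ_complex, cls_nonzero]
  ring

end

end TwistedHopf

namespace TwistedHopf

noncomputable section

/-! ### Commuting pairs -/

/-- The pairs `(t, d)`, with a polynomial `α + β x` that is invertible modulo `x² - t x + d`. -/
def unitSet (g : ℂ × ℂ → ℂ) : Set ((ℂ × ℂ) × ℂ × ℂ) :=
  -- The quadratic form is the norm of α + βx, equal to det(α + βA) for A of trace t and determinant
  -- d.
  {x | x.2.1 ^ 2 + x.2.1 * x.2.2 * x.1.1 + x.2.2 ^ 2 * x.1.2 ≠ 0 ∧ x.1.2 ≠ 0 ∧ g x.1 = 0}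

/-- The pairs of eigenvalues, with a polynomial `α + β x` that does not vanish at them. -/
def unitEigenSet (g : ℂ × ℂ → ℂ) : Set ((ℂ × ℂ) × ℂ × ℂ) :=
  {x | x.2.1 + x.2.2 * x.1.1 ≠ 0 ∧ x.2.1 + x.2.2 * x.1.2 ≠ 0 ∧
    x.1.1 ≠ 0 ∧ x.1.2 ≠ 0 ∧ g (x.1.1 + x.1.2, x.1.1 * x.1.2) = 0}

variable {g : ℂ × ℂ → ℂ} (hg : RegOn Set.univ g)

include hg

theorem isAffine_unitSet : IsAffine (unitSet g) := by
  unfold unitSet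
  refine isAffine_ne_and ?_ ?_ (isAffine_ne_and ?_ ?_ (isAffine_eq (hg.comp_univ ?_) ?_)) <;>
    fun_prop

theorem isAffine_unitEigenSet : IsAffine (unitEigenSet g) := by
  unfold unitEigenSet
  refine isAffine_ne_and ?_ ?_ (isAffine_ne_and ?_ ?_ (isAffine_ne_and ?_ ?_
    (isAffine_ne_and ?_ ?_ (isAffine_eq (hg.comp_univ ?_) ?_)))) <;> fun_prop

/-- If β = 0, only α ≠ 0 is required. If β ≠ 0, scaling by β leaves a = α/β with −a not a root of x²
− tx + d. The removed locus, a polynomial with a chosen root, is the set of ordered eigenvalue pairs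
(−a, t + a). -/
theorem cls_unitSet : cls (unitSet g) =
    (lefschetz - 1) * ((lefschetz + 1) * cls (charSet g) - cls (eigenSet g)) := by
  let S : Set ((ℂ × ℂ) × ℂ) :=
    {x | x.2 ^ 2 + x.2 * x.1.1 + x.1.2 ≠ 0 ∧ x.1 ∈ charSet g}
  have hS : IsAffine S := by
    refine isAffine_ne_and ?_ ?_ (isAffine_ne_and ?_ ?_ (isAffine_eq (hg.comp_univ ?_) ?_)) <;>
      fun_prop
  have h0 := cls_eq_add (isAffine_unitSet hg) (f := fun x => x.2.2) (by fun_prop)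
    (Z := {x | x ∈ unitSet g ∧ x.2.2 = 0}) (U := {x | x ∈ unitSet g ∧ x.2.2 ≠ 0})
    (fun _ => Iff.rfl) (fun _ => Iff.rfl)
  have h1 := cls_eq_add ((isAffine_charSet hg).prod (isAffine_univ (E := ℂ)))
    (f := fun x => x.2 ^ 2 + x.2 * x.1.1 + x.1.2) (by fun_prop)
    (Z := {x | x.2 ^ 2 + x.2 * x.1.1 + x.1.2 = 0 ∧ x.1 ∈ charSet g}) (U := S)
    (by simp [and_comm]) (by simp [S, and_comm])
  let e1 : RegIso {x : (ℂ × ℂ) × ℂ | x.2 ^ 2 + x.2 * x.1.1 + x.1.2 = 0 ∧ x.1 ∈ charSet g}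
      (eigenSet g) :=
    { toFun := fun x => (-x.2, x.1.1 + x.2)
      invFun := fun p => ((p.1 + p.2, p.1 * p.2), -p.1)
      mapsTo := by
        rintro ⟨⟨t, d⟩, a⟩ ⟨h, h2, h3⟩
        dsimp only at h h2
        obtain rfl : d = -a * (t + a) := by linear_combination h
        obtain ⟨h4, h5⟩ := mul_ne_zero_iff.mp h2
        refine ⟨h4, h5, ?_⟩
        convert h3 using 3
        ring
      mapsTo_inv := by
        rintro ⟨a, b⟩ ⟨h1, h2, h3⟩
        refine ⟨?_, mul_ne_zero h1 h2, h3⟩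
        dsimp only
        ring
      left_inv := by
        rintro ⟨⟨t, d⟩, a⟩ ⟨h, -⟩
        dsimp only at h
        simp only [Prod.mk.injEq]
        refine ⟨⟨by ring, ?_⟩, by ring⟩
        linear_combination -h
      right_inv := by
        rintro ⟨a, b⟩ -
        simp
      regOn := by fun_prop
      regOn_inv := by fun_prop }
  let e2 : RegIso {x | x ∈ unitSet g ∧ x.2.2 = 0} (charSet g ×ˢ {a : ℂ | a ≠ 0}) :=
    { toFun := fun x => (x.1, x.2.1)
      invFun := fun x => (x.1, x.2, 0)
      mapsTo := by
        rintro ⟨p, a, b⟩ ⟨⟨h1, h2⟩, rfl : b = 0⟩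
        exact ⟨h2, by simpa using h1⟩
      mapsTo_inv := by
        rintro ⟨p, a⟩ ⟨h1, h2⟩
        exact ⟨⟨by simpa using h2, h1⟩, rfl⟩
      left_inv := by
        rintro ⟨p, a, b⟩ ⟨-, rfl : b = 0⟩
        rfl
      right_inv := fun _ _ => rfl
      regOn := by fun_prop
      regOn_inv := by fun_prop }
  let e3 : RegIso {x | x ∈ unitSet g ∧ x.2.2 ≠ 0} (S ×ˢ {a : ℂ | a ≠ 0}) :=
    { toFun := fun x => ((x.1, x.2.1 / x.2.2), x.2.2)
      invFun := fun x => (x.1.1, x.1.2 * x.2, x.2)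
      mapsTo := by
        rintro ⟨⟨t, d⟩, a, b⟩ ⟨⟨h1, h2⟩, h3 : b ≠ 0⟩
        refine ⟨⟨fun h => h1 ?_, h2⟩, h3⟩
        dsimp only at h ⊢
        field_simp at h
        linear_combination h
      mapsTo_inv := by
        rintro ⟨⟨⟨t, d⟩, a⟩, b⟩ ⟨⟨h1, h2⟩, h3 : b ≠ 0⟩
        refine ⟨⟨fun h => h1 ?_, h2⟩, h3⟩
        refine (mul_eq_zero.mp (?_ : b ^ 2 * _ = 0)).resolve_left (pow_ne_zero 2 h3)
        dsimp only at h ⊢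
        linear_combination h
      left_inv := by
        rintro ⟨⟨t, d⟩, a, b⟩ ⟨-, h3 : b ≠ 0⟩
        simp [h3]
      right_inv := by
        rintro ⟨⟨⟨t, d⟩, a⟩, b⟩ ⟨-, h3 : b ≠ 0⟩
        simp [h3]
      regOn := by
        have := fun x (hx : x ∈ {x | x ∈ unitSet g ∧ x.2.2 ≠ 0}) => hx.2
        fun_prop (disch := assumption)
      regOn_inv := by fun_prop }
  rw [cls_prod (isAffine_charSet hg) isAffine_univ, e1.cls_eq, cls_univ_complex] at h1
  rw [h0, e2.cls_eq, e3.cls_eq, cls_prod (isAffine_charSet hg) isAffine_nonzero,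
    cls_prod hS isAffine_nonzero, cls_nonzero]
  linear_combination -(lefschetz - 1) * h1

/-- For distinct eigenvalues, interpolation makes the two nonzero values of α + βx free coordinates.
For a double eigenvalue there is one nonzero value, and β is free. -/
theorem cls_unitEigenSet : cls (unitEigenSet g) =
    (lefschetz - 1) ^ 2 * cls (distinctEigenSet g) +
      lefschetz * (lefschetz - 1) * cls (scalarSet g) := by
  have h0 := cls_eq_add (isAffine_unitEigenSet hg) (f := fun x => x.1.1 - x.1.2) (by fun_prop)
    (Z := {x | x ∈ unitEigenSet g ∧ x.1.1 = x.1.2})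
    (U := {x | x ∈ unitEigenSet g ∧ x.1.1 ≠ x.1.2})
    (by simp [sub_eq_zero]) (by simp [sub_eq_zero])
  let e1 : RegIso {x | x ∈ unitEigenSet g ∧ x.1.1 = x.1.2}
      (scalarSet g ×ˢ ({a : ℂ | a ≠ 0} ×ˢ (Set.univ : Set ℂ))) :=
    { toFun := fun x => (x.1.1, x.2.1 + x.2.2 * x.1.1, x.2.2)
      invFun := fun x => ((x.1, x.1), x.2.1 - x.2.2 * x.1, x.2.2)
      mapsTo := by
        rintro ⟨⟨a, _⟩, b, c⟩ ⟨⟨h1, h2, h3, h4, h5⟩, rfl : a = _⟩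
        exact ⟨⟨h3, h5⟩, h1, trivial⟩
      mapsTo_inv := by
        rintro ⟨a, b, c⟩ ⟨⟨h1, h2⟩, h3 : b ≠ 0, -⟩
        simpa [unitEigenSet] using ⟨h3, h1, h2⟩
      left_inv := by
        rintro ⟨⟨a, _⟩, b, c⟩ ⟨-, rfl : a = _⟩
        simp
      right_inv := by
        rintro ⟨a, b, c⟩ -
        simp
      regOn := by fun_prop
      regOn_inv := by fun_prop }
  let e2 : RegIso {x | x ∈ unitEigenSet g ∧ x.1.1 ≠ x.1.2}
      (distinctEigenSet g ×ˢ ({a : ℂ | a ≠ 0} ×ˢ {a : ℂ | a ≠ 0})) :=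
    { toFun := fun x => (x.1, x.2.1 + x.2.2 * x.1.1, x.2.1 + x.2.2 * x.1.2)
      invFun := fun x => (x.1, x.2.1 - (x.2.1 - x.2.2) / (x.1.1 - x.1.2) * x.1.1,
        (x.2.1 - x.2.2) / (x.1.1 - x.1.2))
      mapsTo := by
        rintro ⟨p, b, c⟩ ⟨⟨h1, h2, h3⟩, h4⟩
        exact ⟨⟨h4, h3⟩, h1, h2⟩
      mapsTo_inv := by
        rintro ⟨⟨l, m⟩, b, c⟩ ⟨⟨h1 : l ≠ m, h2⟩, h3 : b ≠ 0, h4 : c ≠ 0⟩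
        have h5 : l - m ≠ 0 := sub_ne_zero.mpr h1
        refine ⟨⟨by simpa using h3, ?_, h2⟩, h1⟩
        convert h4 using 1
        field_simp
        ring
      left_inv := by
        rintro ⟨⟨l, m⟩, b, c⟩ ⟨-, h1 : l ≠ m⟩
        have h5 : l - m ≠ 0 := sub_ne_zero.mpr h1
        simp only [Prod.mk.injEq, true_and]
        constructor
        · field_simp
          ring
        · field_simp
          ring
      right_inv := by
        rintro ⟨⟨l, m⟩, b, c⟩ ⟨⟨h1 : l ≠ m, -⟩, -⟩
        have h5 : l - m ≠ 0 := sub_ne_zero.mpr h1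
        simp only [Prod.mk.injEq, true_and]
        constructor
        · ring
        · field_simp
          ring
      regOn := by fun_prop
      regOn_inv := by
        have := fun x (hx : x ∈ distinctEigenSet g ×ˢ ({a : ℂ | a ≠ 0} ×ˢ {a : ℂ | a ≠ 0})) =>
          sub_ne_zero.mpr hx.1.1
        fun_prop (disch := assumption) }
  rw [h0, e1.cls_eq, e2.cls_eq,
    cls_prod (isAffine_scalarSet hg) (isAffine_nonzero.prod isAffine_univ),
    cls_prod (isAffine_distinctEigenSet hg) (isAffine_nonzero.prod isAffine_nonzero),
    cls_prod isAffine_nonzero isAffine_univ, cls_prod isAffine_nonzero isAffine_nonzero,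
    cls_univ_complex, cls_nonzero]
  ring

-- The centralizer of a non-scalar matrix A consists of the matrices α + βA; comparing upper right
-- entries gives β = y/b, and the upper left entry gives α.
omit hg in
theorem Commutes.eq_of_upper {a b c d x y z w : ℂ} (h : Commutes (a, b, c, d) (x, y, z, w))
    (hb : b ≠ 0) :
    ∃ α β, x = α + β * a ∧ y = β * b ∧ z = β * c ∧ w = α + β * d := by
  obtain ⟨h1, h2, -⟩ := h
  dsimp only at h1 h2
  refine ⟨x - y / b * a, y / b, by ring, by field_simp, ?_, ?_⟩
  · field_simp
    linear_combination h1
  · field_simp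
    linear_combination h2

omit hg in
theorem Commutes.eq_of_lower {a c d x y z w : ℂ} (h : Commutes (a, 0, c, d) (x, y, z, w))
    (hc : c ≠ 0) :
    ∃ α β, x = α + β * a ∧ y = 0 ∧ z = β * c ∧ w = α + β * d := by
  obtain ⟨h1, -, h3⟩ := h
  dsimp only at h1 h3
  refine ⟨x - z / c * a, z / c, by ring, ?_, by field_simp, ?_⟩
  · simpa [hc] using h1.symm
  · field_simp
    linear_combination h3

omit hg in
/-- Commuting pairs whose first matrix has a nonzero upper right entry. -/
def commIsoUnit (g : ℂ × ℂ → ℂ) : RegIso {x | x ∈ commSet g ∧ x.1.2.1 ≠ 0}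
    (unitSet g ×ˢ ((Set.univ : Set ℂ) ×ˢ {b : ℂ | b ≠ 0})) where
  -- The coordinates are (t, d), the pair (α, β) with B = α + βA, and the first row of A.
  toFun x := ((charPair x.1, x.2.1 - x.2.2.1 / x.1.2.1 * x.1.1, x.2.2.1 / x.1.2.1),
    x.1.1, x.1.2.1)
  invFun x :=
    ((x.2.1, x.2.2, (x.2.1 * (x.1.1.1 - x.2.1) - x.1.1.2) / x.2.2, x.1.1.1 - x.2.1),
      (x.1.2.1 + x.1.2.2 * x.2.1, x.1.2.2 * x.2.2,
        x.1.2.2 * ((x.2.1 * (x.1.1.1 - x.2.1) - x.1.1.2) / x.2.2),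
        x.1.2.1 + x.1.2.2 * (x.1.1.1 - x.2.1)))
  mapsTo := by
    rintro ⟨⟨a, b, c, d⟩, x, y, z, w⟩ ⟨⟨h1, h2, h3, h4⟩, h5 : b ≠ 0⟩
    obtain ⟨α, β, rfl, rfl, rfl, rfl⟩ := h4.eq_of_upper h5
    refine ⟨⟨?_, h1, h2⟩, trivial, h5⟩
    convert h3 using 1
    simp only [charPair]
    field_simp
    ring
  mapsTo_inv := by
    rintro ⟨⟨⟨t, d⟩, α, β⟩, a, b⟩ ⟨⟨h1, h2, h3⟩, -, h4 : b ≠ 0⟩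
    have h5 : charPair (a, b, (a * (t - a) - d) / b, t - a) = (t, d) := by
      simp only [charPair, Prod.mk.injEq]
      constructor
      · ring
      · field_simp
        ring
    refine ⟨⟨by rwa [h5], by rwa [h5], ?_, ?_, ?_, ?_⟩, h4⟩
    · convert h1 using 1
      simp only [charPair]
      field_simp
      ring
    · ring
    · ring
    · ring
  left_inv := by
    rintro ⟨⟨a, b, c, d⟩, x, y, z, w⟩ ⟨⟨-, -, -, h4⟩, h5 : b ≠ 0⟩
    obtain ⟨α, β, rfl, rfl, rfl, rfl⟩ := h4.eq_of_upper h5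
    simp only [charPair, Prod.mk.injEq]
    refine ⟨⟨trivial, trivial, ?_, by ring⟩, by ring, ?_, ?_, ?_⟩
    · field_simp
      ring
    · field_simp
    · field_simp
      ring
    · field_simp
      ring
  right_inv := by
    rintro ⟨⟨⟨t, d⟩, α, β⟩, a, b⟩ ⟨-, -, h4 : b ≠ 0⟩
    simp only [charPair, Prod.mk.injEq]
    refine ⟨⟨⟨?_, ?_⟩, ?_, ?_⟩, trivial⟩
    · ring
    · field_simp
      ring
    · field_simp
      ring
    · field_simp
  regOn := by
    have := fun x (hx : x ∈ {x | x ∈ commSet g ∧ x.1.2.1 ≠ 0}) => hx.2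
    fun_prop (disch := assumption)
  regOn_inv := by
    have := fun x (hx : x ∈ unitSet g ×ˢ ((Set.univ : Set ℂ) ×ˢ {b : ℂ | b ≠ 0})) => hx.2.2
    fun_prop (disch := assumption)

omit hg in
/-- Commuting pairs whose first matrix is lower triangular but not diagonal. -/
def commIsoUnitEigen (g : ℂ × ℂ → ℂ) : RegIso
    {x | (x ∈ commSet g ∧ x.1.2.1 = 0) ∧ x.1.2.2.1 ≠ 0} (unitEigenSet g ×ˢ {c : ℂ | c ≠ 0}) where
  toFun x := (((x.1.1, x.1.2.2.2), x.2.1 - x.2.2.2.1 / x.1.2.2.1 * x.1.1,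
    x.2.2.2.1 / x.1.2.2.1), x.1.2.2.1)
  invFun x := ((x.1.1.1, 0, x.2, x.1.1.2), x.1.2.1 + x.1.2.2 * x.1.1.1, 0, x.1.2.2 * x.2,
    x.1.2.1 + x.1.2.2 * x.1.1.2)
  mapsTo := by
    rintro ⟨⟨a, b, c, d⟩, x, y, z, w⟩ ⟨⟨⟨h1, h2, h3, h4⟩, rfl : b = 0⟩, h5 : c ≠ 0⟩
    obtain ⟨α, β, rfl, rfl, rfl, rfl⟩ := h4.eq_of_lower h5
    simp_all [charPair, unitEigenSet]
  mapsTo_inv := by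
    rintro ⟨⟨⟨l, m⟩, α, β⟩, c⟩ ⟨⟨h1, h2, h3, h4, h5⟩, h6 : c ≠ 0⟩
    refine ⟨⟨⟨?_, ?_, ?_, ?_, ?_, ?_⟩, rfl⟩, h6⟩
    · simpa [charPair] using ⟨h3, h4⟩
    · simpa [charPair] using h5
    · simpa [charPair] using ⟨h1, h2⟩
    all_goals ring
  left_inv := by
    rintro ⟨⟨a, b, c, d⟩, x, y, z, w⟩ ⟨⟨⟨-, -, -, h4⟩, rfl : b = 0⟩, h5 : c ≠ 0⟩
    obtain ⟨α, β, rfl, rfl, rfl, rfl⟩ := h4.eq_of_lower h5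
    simp [h5]
  right_inv := by
    rintro ⟨⟨⟨l, m⟩, α, β⟩, c⟩ ⟨-, h6 : c ≠ 0⟩
    simp [h6]
  regOn := by
    have := fun x (hx : x ∈ {x | (x ∈ commSet g ∧ x.1.2.1 = 0) ∧ x.1.2.2.1 ≠ 0}) => hx.2
    fun_prop (disch := assumption)
  regOn_inv := by fun_prop

omit hg in
/-- Commuting pairs whose first matrix is diagonal but not scalar. -/
def commIsoDistinct (g : ℂ × ℂ → ℂ) : RegIso
    {x | ((x ∈ commSet g ∧ x.1.2.1 = 0) ∧ x.1.2.2.1 = 0) ∧ x.1.1 ≠ x.1.2.2.2}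
    (distinctEigenSet g ×ˢ ({a : ℂ | a ≠ 0} ×ˢ {a : ℂ | a ≠ 0})) where
  toFun x := ((x.1.1, x.1.2.2.2), x.2.1, x.2.2.2.2)
  invFun x := ((x.1.1, 0, 0, x.1.2), x.2.1, 0, 0, x.2.2)
  mapsTo := by
    rintro ⟨⟨a, b, c, d⟩, x, y, z, w⟩
      ⟨⟨⟨⟨h1, h2, h3, h4, h5, h6⟩, rfl : b = 0⟩, rfl : c = 0⟩, h7 : a ≠ d⟩
    simp_all [charPair, distinctEigenSet, sub_eq_zero]
  mapsTo_inv := by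
    rintro ⟨⟨a, d⟩, x, w⟩ ⟨⟨h1, h2, h3, h4⟩, h5 : x ≠ 0, h6 : w ≠ 0⟩
    simp_all [commSet, Commutes, charPair]
  left_inv := by
    rintro ⟨⟨a, b, c, d⟩, x, y, z, w⟩
      ⟨⟨⟨⟨-, -, -, h4, h5, h6⟩, rfl : b = 0⟩, rfl : c = 0⟩, h7 : a ≠ d⟩
    simp_all [sub_eq_zero]
  right_inv := fun _ _ => rfl
  regOn := by fun_prop
  regOn_inv := by fun_prop

omit hg in
/-- Commuting pairs whose first matrix is scalar. -/
def commIsoScalar (g : ℂ × ℂ → ℂ) : RegIso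
    {x | ((x ∈ commSet g ∧ x.1.2.1 = 0) ∧ x.1.2.2.1 = 0) ∧ x.1.1 = x.1.2.2.2}
    (scalarSet g ×ˢ matSet 0) where
  toFun x := (x.1.1, x.2)
  invFun x := ((x.1, 0, 0, x.1), x.2)
  mapsTo := by
    rintro ⟨⟨a, b, c, d⟩, B⟩
      ⟨⟨⟨⟨h1, h2, h3, h4, h5, h6⟩, rfl : b = 0⟩, rfl : c = 0⟩, rfl : a = d⟩
    refine ⟨?_, h3, rfl⟩
    simp_all [charPair, scalarSet]
  mapsTo_inv := by
    rintro ⟨a, B⟩ ⟨h1, h2⟩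
    simp_all [commSet, Commutes, charPair, scalarSet, matSet]
  left_inv := by
    rintro ⟨⟨a, b, c, d⟩, B⟩ ⟨⟨⟨-, rfl : b = 0⟩, rfl : c = 0⟩, rfl : a = d⟩
    rfl
  right_inv := fun _ _ => rfl
  regOn := by fun_prop
  regOn_inv := by fun_prop

/-! ### The unconstrained case g = 0 -/

omit hg in
theorem cls_charSet_zero : cls (charSet 0) = lefschetz * (lefschetz - 1) := by
  have : charSet 0 = (Set.univ : Set ℂ) ×ˢ {a : ℂ | a ≠ 0} := by
    ext x
    simp [charSet]
  rw [this, cls_prod isAffine_univ isAffine_nonzero, cls_univ_complex, cls_nonzero]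

omit hg in
theorem cls_eigenSet_zero : cls (eigenSet 0) = (lefschetz - 1) ^ 2 := by
  have : eigenSet 0 = {a : ℂ | a ≠ 0} ×ˢ {a : ℂ | a ≠ 0} := by
    ext x
    simp [eigenSet]
  rw [this, cls_prod isAffine_nonzero isAffine_nonzero, cls_nonzero, sq]

omit hg in
theorem cls_scalarSet_zero : cls (scalarSet 0) = lefschetz - 1 := by
  rw [← cls_nonzero]
  congr 1
  ext x
  simp [scalarSet]

omit hg in
theorem regOn_zero : RegOn (Set.univ : Set (ℂ × ℂ)) (0 : ℂ × ℂ → ℂ) := RegOn.const _ 0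

omit hg in
/-- The motive of `GL₂`. -/
theorem cls_matSet_zero :
    cls (matSet 0) = lefschetz * (lefschetz + 1) * (lefschetz - 1) ^ 2 := by
  rw [cls_matSet regOn_zero, cls_charSet_zero, cls_eigenSet_zero]
  ring

/-- The strata of A are: b ≠ 0; b = 0 with c ≠ 0; diagonal non-scalar; scalar. After [`eigenSet g`]
is split into distinct and equal eigenvalues, the contributions of `distinctEigenSet g` cancel, and
of the scalar terms only [GL₂]·[`scalarSet g`] remains. -/
theorem cls_commSet : cls (commSet g) =
    cls (matSet 0) * (cls (charSet g) + cls (scalarSet g)) := by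
  have h1 : ∀ x, x ∈ {x | x ∈ commSet g ∧ x.1.2.1 = 0} ↔ x ∈ commSet g ∧ x.1.2.1 = 0 :=
    fun _ => Iff.rfl
  have a1 : IsAffine {x | x ∈ commSet g ∧ x.1.2.1 = 0} :=
    (isAffine_commSet hg).zeros (by fun_prop) h1
  have h2 : ∀ x, x ∈ {x | (x ∈ commSet g ∧ x.1.2.1 = 0) ∧ x.1.2.2.1 = 0} ↔
    x ∈ {x | x ∈ commSet g ∧ x.1.2.1 = 0} ∧ x.1.2.2.1 = 0 := fun _ => Iff.rfl
  have a2 : IsAffine {x | (x ∈ commSet g ∧ x.1.2.1 = 0) ∧ x.1.2.2.1 = 0} :=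
    a1.zeros (by fun_prop) h2
  rw [cls_eq_add (isAffine_commSet hg) (by fun_prop) h1
      (U := {x | x ∈ commSet g ∧ x.1.2.1 ≠ 0}) (fun _ => Iff.rfl),
    cls_eq_add a1 (by fun_prop) h2
      (U := {x | (x ∈ commSet g ∧ x.1.2.1 = 0) ∧ x.1.2.2.1 ≠ 0}) (fun _ => Iff.rfl),
    cls_eq_add a2 (f := fun x => x.1.1 - x.1.2.2.2) (by fun_prop)
      (Z := {x | ((x ∈ commSet g ∧ x.1.2.1 = 0) ∧ x.1.2.2.1 = 0) ∧ x.1.1 = x.1.2.2.2})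
      (U := {x | ((x ∈ commSet g ∧ x.1.2.1 = 0) ∧ x.1.2.2.1 = 0) ∧ x.1.1 ≠ x.1.2.2.2})
      (by simp [sub_eq_zero]) (by simp [sub_eq_zero])]
  have e1 := (commIsoUnit g).cls_eq
  rw [(commIsoUnitEigen g).cls_eq, (commIsoDistinct g).cls_eq, (commIsoScalar g).cls_eq,
    cls_prod (isAffine_scalarSet hg) (isAffine_matSet regOn_zero),
    cls_prod (isAffine_distinctEigenSet hg) (isAffine_nonzero.prod isAffine_nonzero),
    cls_prod isAffine_nonzero isAffine_nonzero,
    cls_prod (isAffine_unitEigenSet hg) isAffine_nonzero, cls_nonzero, cls_unitEigenSet hg]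
  rw [cls_prod (isAffine_unitSet hg) (isAffine_univ.prod isAffine_nonzero),
    cls_prod isAffine_univ isAffine_nonzero, cls_univ_complex, cls_nonzero, cls_unitSet hg,
    cls_eigenSet hg] at e1
  rw [e1, cls_matSet_zero]
  ring

end

end TwistedHopf

namespace TwistedHopf

noncomputable section

/-! ### Powers of `2 × 2` matrices -/

/-- The Lucas polynomials: `Aⁿ⁺¹ = uₙ₊₁(t, d) A - d uₙ(t, d)` for a `2 × 2` matrix `A` of trace `t`
and determinant `d`. -/
def lucas : ℕ → ℂ × ℂ → ℂ
  | 0, _ => 0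
  | 1, _ => 1
  | n + 2, p => p.1 * lucas (n + 1) p - p.2 * lucas n p

theorem regOn_lucas (n : ℕ) : RegOn Set.univ (lucas n) := by
  induction n using Nat.twoStepInduction with
  | zero => exact RegOn.const _ 0
  | one => exact RegOn.const _ 1
  | more n h1 h2 =>
    have : lucas (n + 2) = fun p => p.1 * lucas (n + 1) p - p.2 * lucas n p := rfl
    rw [this]
    exact (RegOn.mul (by fun_prop) h2).sub (RegOn.mul (by fun_prop) h1)

/-- Both sides satisfy the recurrence with roots a and b. The identity is empty for a = b, where
`lucas_succ_self` takes over. -/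
theorem lucas_mul_sub (n : ℕ) (a b : ℂ) : lucas n (a + b, a * b) * (a - b) = a ^ n - b ^ n := by
  induction n using Nat.twoStepInduction with
  | zero => simp [lucas]
  | one => simp [lucas]
  | more n h1 h2 =>
    rw [lucas]
    linear_combination (a + b) * h2 - a * b * h1

theorem lucas_succ_self (n : ℕ) (a : ℂ) : lucas (n + 1) (a + a, a * a) = (n + 1) * a ^ n := by
  induction n using Nat.twoStepInduction with
  | zero => simp [lucas]
  | one => simp [lucas]; ring
  | more n h1 h2 =>
    rw [lucas]
    push_cast at h2 ⊢
    linear_combination (a + a) * h2 - a * a * h1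

/-- At a double eigenvalue the value is n aⁿ⁻¹, nonzero in characteristic zero. Thus u_n = 0 forces
distinct eigenvalues. -/
theorem lucas_self_ne_zero {n : ℕ} (hn : 1 ≤ n) {a : ℂ} (ha : a ≠ 0) :
    lucas n (a + a, a * a) ≠ 0 := by
  obtain ⟨m, rfl⟩ := Nat.exists_eq_add_of_le' hn
  rw [lucas_succ_self]
  exact mul_ne_zero (Nat.cast_add_one_ne_zero m) (pow_ne_zero m ha)

theorem lucas_eq_zero_iff {n : ℕ} (hn : 1 ≤ n) {a b : ℂ} (ha : a ≠ 0) :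
    lucas n (a + b, a * b) = 0 ↔ a ≠ b ∧ a ^ n = b ^ n := by
  have h := lucas_mul_sub n a b
  by_cases hab : a = b
  · subst hab
    simp [lucas_self_ne_zero hn ha]
  · rw [← mul_eq_zero_iff_right (sub_ne_zero.mpr hab), h, sub_eq_zero]
    simp [hab]

theorem exists_eigenvalues (t d : ℂ) : ∃ a b : ℂ, t = a + b ∧ d = a * b := by
  obtain ⟨s, hs⟩ := IsAlgClosed.exists_pow_nat_eq (t ^ 2 - 4 * d) (n := 2) (by norm_num)
  exact ⟨(t + s) / 2, (t - s) / 2, by ring, by linear_combination hs / 4⟩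

/-! ### Matrices with a scalar power -/

variable {n : ℕ} (hn : 1 ≤ n)

include hn

theorem cls_scalarSet_lucas : cls (scalarSet (lucas n)) = 0 := by
  rw [← cls_empty (E := ℂ)]
  congr 1
  exact Set.eq_empty_of_forall_notMem fun a ha => lucas_self_ne_zero hn ha.1 ha.2

/-- The ratio a/b takes the n − 1 nontrivial n-th roots of unity as values, and each fibre is a
punctured line with coordinate b. -/
theorem cls_eigenSet_lucas :
    cls (eigenSet (lucas n)) = ((n : GrothendieckRing) - 1) * (lefschetz - 1) := by
  have key : ∀ p ∈ eigenSet (lucas n), p.1 / p.2 ≠ 1 ∧ (p.1 / p.2) ^ n = 1 := by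
    rintro ⟨a, b⟩ ⟨h1 : a ≠ 0, h2 : b ≠ 0, h3⟩
    obtain ⟨h4, h5⟩ := (lucas_eq_zero_iff hn h1).mp h3
    simp only [div_pow]
    rw [h5, Ne, div_eq_one_iff_eq h2]
    exact ⟨h4, div_self (pow_ne_zero n h2)⟩
  have hne := fun p (hp : p ∈ eigenSet (lucas n)) => hp.2.1
  rw [cls_eq_sum (f := fun p => p.1 / p.2) ((Polynomial.nthRootsFinset n (1 : ℂ)).erase 1)
    (isAffine_eigenSet (regOn_lucas n)) (by fun_prop (disch := assumption)) fun p hp => by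
      rw [Finset.mem_erase, Polynomial.mem_nthRootsFinset hn]
      exact key p hp]
  have hcls : ∀ ζ ∈ (Polynomial.nthRootsFinset n (1 : ℂ)).erase 1,
      cls {p | p ∈ eigenSet (lucas n) ∧ p.1 / p.2 = ζ} = lefschetz - 1 := by
    intro ζ hζ
    rw [Finset.mem_erase, Polynomial.mem_nthRootsFinset hn] at hζ
    have h0 : ζ ≠ 0 := by
      rintro rfl
      simp [show n ≠ 0 by omega] at hζ
    rw [← cls_nonzero]
    exact RegIso.cls_eq
      { toFun := fun p => p.2
        invFun := fun b => (ζ * b, b)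
        mapsTo := fun p hp => hp.1.2.1
        mapsTo_inv := fun b (hb : b ≠ 0) => by
          refine ⟨⟨mul_ne_zero h0 hb, hb, ?_⟩, by simp [hb]⟩
          rw [lucas_eq_zero_iff hn (mul_ne_zero h0 hb), mul_pow, hζ.2]
          simp [hb, hζ.1]
        left_inv := by
          rintro ⟨a, b⟩ ⟨⟨-, h2 : b ≠ 0, -⟩, rfl⟩
          simp [h2]
        right_inv := fun _ _ => rfl
        regOn := by fun_prop
        regOn_inv := by fun_prop }
  have hcard : (Polynomial.nthRootsFinset n (1 : ℂ)).card = n :=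
    (Complex.isPrimitiveRoot_exp n (by omega)).card_nthRootsFinset
  rw [Finset.sum_congr rfl hcls, Finset.sum_const, nsmul_eq_mul, Finset.card_erase_of_mem, hcard,
    Nat.cast_sub hn, Nat.cast_one]
  rw [Polynomial.mem_nthRootsFinset hn, one_pow]

-- For eigenvalue ratio x, the invariant t²/d equals (1 + x)²/x = x + 2 + 1/x, which determines x up
-- to inversion.
omit hn in
theorem add_sq_div_eq_iff {x y : ℂ} (hx : x ≠ 0) (hy : y ≠ 0) :
    (1 + x) ^ 2 / x = (1 + y) ^ 2 / y ↔ x = y ∨ x * y = 1 := by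
  rw [div_eq_div_iff hx hy, ← sub_eq_zero, ← sub_eq_zero (a := x), ← sub_eq_zero (a := x * y),
    ← mul_eq_zero]
  constructor <;> intro h <;> linear_combination h

-- For w ≠ 0 the curve is parametrized by t. For w = 0, which is the eigenvalue ratio −1, t vanishes
-- and d is the coordinate.
omit hn in
theorem cls_parabola (w : ℂ) : cls {p : ℂ × ℂ | p.2 ≠ 0 ∧ p.1 ^ 2 = w * p.2} = lefschetz - 1 := by
  rw [← cls_nonzero]
  by_cases hw : w = 0
  · exact RegIso.cls_eq
      { toFun := fun p => p.2
        invFun := fun d => (0, d)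
        mapsTo := fun p hp => hp.1
        mapsTo_inv := fun d hd => ⟨hd, by simp [hw]⟩
        left_inv := by
          rintro ⟨t, d⟩ ⟨-, h⟩
          simp_all
        right_inv := fun _ _ => rfl
        regOn := by fun_prop
        regOn_inv := by fun_prop }
  · exact RegIso.cls_eq
      { toFun := fun p => p.1
        invFun := fun t => (t, t ^ 2 / w)
        mapsTo := by
          rintro ⟨t, d⟩ ⟨h1, h2⟩ rfl
          simp_all
        mapsTo_inv := fun t (ht : t ≠ 0) => by
          refine ⟨div_ne_zero (pow_ne_zero 2 ht) hw, ?_⟩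
          field_simp
        left_inv := by
          rintro ⟨t, d⟩ ⟨-, h⟩
          simp only [Prod.mk.injEq, true_and]
          rw [div_eq_iff hw]
          linear_combination h
        right_inv := fun _ _ => rfl
        regOn := by fun_prop
        regOn_inv := by fun_prop (disch := exact fun _ _ => hw) }

/-- Exchanging the eigenvalues inverts their ratio, so t²/d indexes nontrivial roots of unity up to
inversion. The exponents 1, …, ⌊n/2⌋ represent them once each, and each fibre is a curve t² = wd. -/
theorem cls_charSet_lucas :
    cls (charSet (lucas n)) = ((n / 2 : ℕ) : GrothendieckRing) * (lefschetz - 1) := by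
  obtain ⟨ζ, hζ⟩ : ∃ ζ : ℂ, IsPrimitiveRoot ζ n := ⟨_, Complex.isPrimitiveRoot_exp n (by omega)⟩
  have : NeZero n := ⟨by omega⟩
  have hζ0 : ∀ k, ζ ^ k ≠ 0 := fun k => pow_ne_zero k (hζ.ne_zero (by omega))
  let h : ℕ → ℂ := fun k => (1 + ζ ^ k) ^ 2 / ζ ^ k
  have hinj : Set.InjOn h (Finset.Icc 1 (n / 2) : Finset ℕ) := by
    intro j hj k hk hjk
    rw [Finset.mem_coe, Finset.mem_Icc] at hj hk
    rcases (add_sq_div_eq_iff (hζ0 j) (hζ0 k)).mp hjk with h1 | h1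
    · exact hζ.pow_inj (by omega) (by omega) h1
    -- Here n divides j + k ≤ 2⌊n/2⌋ ≤ n, which forces j = k = n/2.
    · rw [← pow_add, hζ.pow_eq_one_iff_dvd] at h1
      have := Nat.le_of_dvd (by omega) h1
      omega
  have key : ∀ p ∈ charSet (lucas n), p.1 ^ 2 / p.2 ∈ (Finset.Icc 1 (n / 2)).image h := by
    rintro ⟨t, d⟩ ⟨hd, hu⟩
    obtain ⟨a, b, rfl, rfl⟩ := exists_eigenvalues t d
    obtain ⟨ha, hb⟩ := mul_ne_zero_iff.mp hd
    obtain ⟨hab, hpow⟩ := (lucas_eq_zero_iff hn ha).mp hu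
    obtain ⟨i, hi, hia⟩ := hζ.eq_pow_of_pow_eq_one (ξ := a / b)
      (by rw [div_pow, hpow, div_self (pow_ne_zero n hb)])
    have hi0 : i ≠ 0 := by
      rintro rfl
      rw [pow_zero, eq_comm, div_eq_one_iff_eq hb] at hia
      exact hab hia
    have hval : (a + b) ^ 2 / (a * b) = h i := by
      simp only [h, hia]
      field_simp
      ring
    rw [hval, Finset.mem_image]
    by_cases hin : i ≤ n / 2
    · exact ⟨i, by rw [Finset.mem_Icc]; omega, rfl⟩
    · refine ⟨n - i, by rw [Finset.mem_Icc]; omega, ?_⟩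
      refine (add_sq_div_eq_iff (hζ0 _) (hζ0 _)).mpr (Or.inr ?_)
      rw [← pow_add, Nat.sub_add_cancel hi.le, hζ.pow_eq_one]
  have hne := fun p (hp : p ∈ charSet (lucas n)) => hp.1
  rw [cls_eq_sum (f := fun p => p.1 ^ 2 / p.2) _ (isAffine_charSet (regOn_lucas n))
    (by fun_prop (disch := assumption)) key]
  have hcls : ∀ w ∈ (Finset.Icc 1 (n / 2)).image h,
      cls {p | p ∈ charSet (lucas n) ∧ p.1 ^ 2 / p.2 = w} = lefschetz - 1 := by
    intro w hw
    obtain ⟨k, hk, rfl⟩ := Finset.mem_image.mp hw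
    rw [Finset.mem_Icc] at hk
    rw [← cls_parabola (h k)]
    congr 1
    ext ⟨t, d⟩
    constructor
    · rintro ⟨⟨h1, -⟩, h2⟩
      exact ⟨h1, (div_eq_iff h1).mp h2⟩
    · rintro ⟨h1, h2⟩
      refine ⟨⟨h1, ?_⟩, (div_eq_iff h1).mpr h2⟩
      obtain ⟨a, b, rfl, rfl⟩ := exists_eigenvalues t d
      obtain ⟨ha, hb⟩ := mul_ne_zero_iff.mp h1
      have hk1 : ζ ^ k ≠ 1 := hζ.pow_ne_one_of_pos_of_lt (by omega) (by omega)
      have hkn : (ζ ^ k) ^ n = 1 := by rw [← pow_mul, mul_comm, pow_mul, hζ.pow_eq_one, one_pow]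
      rw [lucas_eq_zero_iff hn ha]
      -- In terms of eigenvalues the equation t² = wd factors: the ratio a/b is ζᵏ or its inverse.
      have h3 : (a - ζ ^ k * b) * (ζ ^ k * a - b) = 0 := by
        have h0 := hζ0 k
        simp only [h] at h2
        field_simp at h2
        linear_combination h2
      rcases mul_eq_zero.mp h3 with h4 | h4
      · rw [sub_eq_zero] at h4
        rw [h4, mul_pow, hkn, one_mul]
        simp [hb, hk1]
      · rw [sub_eq_zero] at h4
        rw [← h4, mul_pow, hkn, one_mul, ne_comm]
        simp [ha, hk1]
  rw [Finset.sum_congr rfl hcls, Finset.sum_const, nsmul_eq_mul, Finset.card_image_of_injOn hinj,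
    Nat.card_Icc, Nat.add_sub_cancel]

/-! ### Pairs of matrices -/

omit hn in
/-- The pairs of invertible matrices `(A, B)` such that `Aⁿ` and `B` commute. -/
def pairSet (n : ℕ) : Set (Mat × Mat) :=
  {x | (charPair x.1).2 ≠ 0 ∧ (charPair x.2).2 ≠ 0 ∧
    lucas n (charPair x.1) * (x.1.2.1 * x.2.2.2.1 - x.1.2.2.1 * x.2.2.1) = 0 ∧
    lucas n (charPair x.1) *
      ((x.1.1 - x.1.2.2.2) * x.2.2.1 - x.1.2.1 * (x.2.1 - x.2.2.2.2)) = 0 ∧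
    lucas n (charPair x.1) *
      ((x.1.1 - x.1.2.2.2) * x.2.2.2.1 - x.1.2.2.1 * (x.2.1 - x.2.2.2.2)) = 0}

omit hn in
theorem isAffine_pairSet (n : ℕ) : IsAffine (pairSet n) := by
  have : RegOn (Set.univ : Set (Mat × Mat)) fun x => lucas n (charPair x.1) :=
    (regOn_lucas n).comp_univ (by fun_prop)
  unfold pairSet
  refine isAffine_ne_and ?_ ?_ (isAffine_ne_and ?_ ?_ (isAffine_eq_and (this.mul ?_) ?_
    (isAffine_eq_and (this.mul ?_) ?_ (isAffine_eq (this.mul ?_) ?_)))) <;> fun_prop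

/-- The set U of commuting pairs with u_n ≠ 0 is the open piece both of `pairSet n` and of all
commuting pairs `commSet 0`. Subtracting the two decompositions eliminates its class. -/
theorem cls_pairSet : cls (pairSet n) =
    lefschetz * (lefschetz + 1) * (lefschetz - 1) ^ 3 *
      (((n / 2 : ℕ) : GrothendieckRing) * lefschetz ^ 2 +
        ((n : GrothendieckRing) - ((n / 2 : ℕ) : GrothendieckRing)) * lefschetz -
        ((n / 2 : ℕ) : GrothendieckRing) + 1) := by
  have hu : RegOn (Set.univ : Set (Mat × Mat)) fun x => lucas n (charPair x.1) :=
    (regOn_lucas n).comp_univ (by fun_prop)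
  let U : Set (Mat × Mat) := {x | x ∈ commSet 0 ∧ lucas n (charPair x.1) ≠ 0}
  have h1 := cls_eq_add (isAffine_pairSet n) (hu.mono (Set.subset_univ _))
    (Z := matSet (lucas n) ×ˢ matSet 0) (U := U)
    (fun x => by
      simp only [pairSet, matSet, Set.mem_prod, Set.mem_ofPred_eq, Pi.zero_apply]
      constructor
      · rintro ⟨⟨h1, h2⟩, h3, -⟩
        simp [h1, h2, h3]
      · rintro ⟨⟨h1, h2, -⟩, h3⟩
        exact ⟨⟨h1, h3⟩, h2, trivial⟩)
    (fun x => by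
      simp only [pairSet, U, commSet, Commutes, Set.mem_ofPred_eq, Pi.zero_apply]
      constructor
      · rintro ⟨⟨h1, -, h2, h3, h4, h5⟩, h6⟩
        simp [h1, h2, h3, h4, h5, h6]
      · rintro ⟨⟨h1, h2, h3, h4, h5⟩, h6⟩
        simp only [mul_eq_zero, h6, false_or, sub_eq_zero] at h3 h4 h5
        exact ⟨⟨h1, trivial, h2, h3, h4, h5⟩, h6⟩)
  have h2 := cls_eq_add (isAffine_commSet regOn_zero) (hu.mono (Set.subset_univ _))
    (Z := commSet (lucas n)) (U := U)
    (fun x => by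
      simp only [commSet, Set.mem_ofPred_eq, Pi.zero_apply]
      tauto)
    (fun x => Iff.rfl)
  rw [cls_prod (isAffine_matSet (regOn_lucas n)) (isAffine_matSet regOn_zero),
    cls_matSet (regOn_lucas n), cls_charSet_lucas hn, cls_eigenSet_lucas hn, cls_matSet_zero] at h1
  rw [cls_commSet regOn_zero, cls_commSet (regOn_lucas n), cls_charSet_lucas hn,
    cls_scalarSet_lucas hn, cls_charSet_zero, cls_scalarSet_zero, cls_matSet_zero] at h2
  linear_combination h1 - h2

end

end TwistedHopf

namespace TwistedHopf

noncomputable section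

open CoordSpace

/-! ### Coordinate rings of representation varieties -/

/-- The complex points of the coordinate ring of `Hom(Γ, GL_r)` are the representations. -/
theorem isAffineRing_repCoordinateRing (Γ : Type) [Group Γ] [Group.FG Γ] (r : ℕ) :
    IsAffineRing (repCoordinateRing Γ r) where
  fg := (Subalgebra.fg_iff_finiteType _).mpr inferInstance
  exists_eval φ := by
    have hmem : ∀ γ i j, matrixCoeff Γ r γ i j ∈ repCoordinateRing Γ r := fun γ i j =>
      Algebra.subset_adjoin ⟨γ, i, j, rfl⟩
    -- The images of the matrix coefficients under φ form matrices. They multiply correctly because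
    -- the coefficients do, and they are invertible because Γ is a group.
    let M : Γ →* Matrix (Fin r) (Fin r) ℂ :=
      { toFun := fun γ => Matrix.of fun i j => φ ⟨_, hmem γ i j⟩
        map_one' := by
          ext i j
          have : (⟨_, hmem 1 i j⟩ : repCoordinateRing Γ r) =
              algebraMap ℂ _ ((1 : Matrix (Fin r) (Fin r) ℂ) i j) :=
            Subtype.ext (funext fun ρ => by simp [matrixCoeff])
          rw [Matrix.of_apply, this, AlgHom.commutes]
          rfl
        map_mul' := fun x y => by
          ext i j
          have : (⟨_, hmem (x * y) i j⟩ : repCoordinateRing Γ r) =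
              ∑ k, ⟨_, hmem x i k⟩ * ⟨_, hmem y k j⟩ :=
            Subtype.ext (funext fun ρ => by simp [matrixCoeff, Matrix.mul_apply])
          rw [Matrix.of_apply, this, map_sum, Matrix.mul_apply]
          exact Finset.sum_congr rfl fun k _ => map_mul φ _ _ }
    refine ⟨M.toHomUnits, ?_⟩
    have : φ = (Pi.evalAlgHom ℂ _ M.toHomUnits).comp (repCoordinateRing Γ r).val := by
      unfold repCoordinateRing
      apply AlgHom.adjoin_ext
      rintro _ ⟨γ, i, j, rfl⟩
      rfl
    exact fun f => congrArg (fun χ : repCoordinateRing Γ r →ₐ[ℂ] ℂ => χ f) this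

/-! ### Matrices -/

/-- The entries of a matrix. -/
def entries (A : Matrix (Fin 2) (Fin 2) ℂ) : Mat := (A 0 0, A 0 1, A 1 0, A 1 1)

theorem charPair_entries (A : Matrix (Fin 2) (Fin 2) ℂ) :
    charPair (entries A) = (A.trace, A.det) := by
  rw [Matrix.trace_fin_two, Matrix.det_fin_two]
  rfl

theorem pow_succ_eq_lucas (A : Matrix (Fin 2) (Fin 2) ℂ) (n : ℕ) :
    A ^ (n + 1) = lucas (n + 1) (A.trace, A.det) • A -
      (A.det * lucas n (A.trace, A.det)) • (1 : Matrix (Fin 2) (Fin 2) ℂ) := by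
  have hA : A * A = A.trace • A - A.det • (1 : Matrix (Fin 2) (Fin 2) ℂ) := by
    rw [Matrix.trace_fin_two, Matrix.det_fin_two]
    ext i j
    fin_cases i <;> fin_cases j <;> simp [Matrix.mul_apply, Fin.sum_univ_two] <;> ring
  induction n with
  | zero => simp [lucas]
  | succ n ih =>
    rw [pow_succ, ih, sub_mul, smul_mul_assoc, smul_mul_assoc, hA, one_mul, lucas]
    module

/-- The scalar part of Aⁿ drops out of the commutator. The three equations of `pairSet` are entries
of u_n(AB − BA) up to sign; the fourth entry is minus the first because the trace vanishes. -/
theorem mem_pairSet_iff {n : ℕ} (hn : 1 ≤ n) (A B : GL (Fin 2) ℂ) :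
    (entries A, entries B) ∈ pairSet n ↔ ⁅A ^ n, B⁆ = 1 := by
  have hA := A.det_ne_zero
  have hB := B.det_ne_zero
  obtain ⟨m, rfl⟩ := Nat.exists_eq_add_of_le' hn
  have key : (A : Matrix (Fin 2) (Fin 2) ℂ) ^ (m + 1) * B - B * A ^ (m + 1) =
      lucas (m + 1) (charPair (entries A)) • ((A : Matrix (Fin 2) (Fin 2) ℂ) * B - B * A) := by
    rw [pow_succ_eq_lucas, charPair_entries]
    simp only [sub_mul, mul_sub, smul_mul_assoc, mul_smul_comm, one_mul, mul_one, smul_sub]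
    abel
  rw [commutatorElement_eq_one_iff_mul_comm, Units.ext_iff, Units.val_mul, Units.val_mul,
    Units.val_pow_eq_pow_val, ← sub_eq_zero, key, ← Matrix.ext_iff]
  simp only [pairSet, Set.mem_ofPred_eq, charPair_entries, Fin.forall_fin_two]
  simp only [entries, Matrix.smul_apply, Matrix.sub_apply, Matrix.mul_apply, Fin.sum_univ_two,
    Matrix.zero_apply, smul_eq_mul]
  constructor
  · rintro ⟨-, -, h1, h2, h3⟩
    exact ⟨⟨by linear_combination h1, by linear_combination h2⟩,
      by linear_combination -h3, by linear_combination -h1⟩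
  · rintro ⟨⟨h1, h2⟩, h3, -⟩
    exact ⟨hA, hB, by linear_combination h1, by linear_combination h2, by linear_combination -h3⟩

/-! ### The representation variety of a twisted Hopf link -/

variable {n : ℕ} (hn : 1 ≤ n)

/-- The pair of matrices that determines a representation. -/
def repPair (ρ : HopfLinkGroup n →* GL (Fin 2) ℂ) : pairSet n :=
  ⟨(entries (ρ (PresentedGroup.of 0)), entries (ρ (PresentedGroup.of 1))),
    (mem_pairSet_iff hn _ _).mpr (hopfRepEquiv n _ ρ).2⟩

/-- Surjectivity makes the pullback of functions from pairs of matrices to representations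
injective. -/
theorem repPair_surjective : Function.Surjective (repPair hn) := by
  have hGL : ∀ A : Mat, (charPair A).2 ≠ 0 → ∃ M : GL (Fin 2) ℂ, entries M = A := by
    rintro ⟨a, b, c, d⟩ h
    exact ⟨Matrix.GeneralLinearGroup.mkOfDetNeZero !![a, b; c, d]
      (by rwa [Matrix.det_fin_two_of]), rfl⟩
  rintro ⟨⟨A, B⟩, h⟩
  obtain ⟨A, rfl⟩ := hGL A h.1
  obtain ⟨B, rfl⟩ := hGL B h.2.1
  have h' := (mem_pairSet_iff hn A B).mp h
  refine ⟨(hopfRepEquiv n _).symm ⟨(A, B), h'⟩, Subtype.ext ?_⟩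
  have := congrArg Subtype.val ((hopfRepEquiv n _).apply_symm_apply ⟨(A, B), h'⟩)
  exact congrArg (fun p : GL (Fin 2) ℂ × GL (Fin 2) ℂ =>
    (entries (p.1 : Matrix (Fin 2) (Fin 2) ℂ), entries (p.2 : Matrix (Fin 2) (Fin 2) ℂ))) this

section

variable {X E F : Type} [CoordSpace E] [CoordSpace F] (R : Subalgebra ℂ (X → ℂ))

theorem poly_le_comap_prod (f : X → E × F) (h1 : poly ≤ R.comap (pull fun x => (f x).1))
    (h2 : poly ≤ R.comap (pull fun x => (f x).2)) : poly ≤ R.comap (pull f) := by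
  refine sup_le ?_ ?_
  · rintro _ ⟨p, hp, rfl⟩
    exact h1 hp
  · rintro _ ⟨p, hp, rfl⟩
    exact h2 hp

theorem poly_le_comap (f : X → ℂ) (h : f ∈ R) : poly ≤ R.comap (pull f) := by
  refine Algebra.adjoin_le ?_
  rintro _ rfl
  exact h

end

theorem pull_poly_mem {p : (Mat × Mat) → ℂ} (hp : p ∈ poly) :
    (fun ρ => p (repPair hn ρ).1) ∈ repCoordinateRing (HopfLinkGroup n) 2 := by
  have hmem : ∀ γ i j, matrixCoeff (HopfLinkGroup n) 2 γ i j ∈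
      repCoordinateRing (HopfLinkGroup n) 2 := fun γ i j => Algebra.subset_adjoin ⟨γ, i, j, rfl⟩
  have : poly ≤ (repCoordinateRing (HopfLinkGroup n) 2).comap
      (pull fun ρ => (repPair hn ρ).1) := by
    -- The product structure is peeled down to the eight matrix entries, each a matrix coefficient.
    repeat' first
      | exact poly_le_comap _ _ (hmem _ _ _)
      | apply poly_le_comap_prod
  exact this hp

section

variable (F : Mat × Mat → Mat) (hF : RegOn (pairSet n) F) (γ : HopfLinkGroup n)
  (hγ : ∀ ρ, F (repPair hn ρ).1 = entries (ρ γ))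

include hF hγ

theorem matrixCoeff_mem (i j : Fin 2) : matrixCoeff (HopfLinkGroup n) 2 γ i j ∈
    (regular (pairSet n)).map (pull (repPair hn)) := by
  have key : ∀ f : Mat → ℂ, (∀ A, f (entries A) = A i j) → RegOn (pairSet n) (fun x => f (F x)) →
      matrixCoeff (HopfLinkGroup n) 2 γ i j ∈ (regular (pairSet n)).map (pull (repPair hn)) := by
    intro f hf hreg
    refine ⟨_, regOn_iff.mp hreg, funext fun ρ => ?_⟩
    change f (F (repPair hn ρ).1) = _
    rw [hγ, hf]
    rfl
  fin_cases i <;> fin_cases j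
  · exact key (fun A => A.1) (fun _ => rfl) (by fun_prop)
  · exact key (fun A => A.2.1) (fun _ => rfl) (by fun_prop)
  · exact key (fun A => A.2.2.1) (fun _ => rfl) (by fun_prop)
  · exact key (fun A => A.2.2.2) (fun _ => rfl) (by fun_prop)

/-- By Cramer's rule the entries of the inverse are adjugate entries divided by the determinant,
which has no zeros on `pairSet n`. -/
theorem matrixCoeff_inv_mem (i j : Fin 2) : matrixCoeff (HopfLinkGroup n) 2 γ⁻¹ i j ∈
    (regular (pairSet n)).map (pull (repPair hn)) := by
  have hdet : ∀ x ∈ pairSet n, (charPair (F x)).2 ≠ 0 := by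
    intro x hx
    obtain ⟨ρ, hρ⟩ := repPair_surjective hn ⟨x, hx⟩
    rw [show x = (repPair hn ρ).1 by rw [hρ], hγ, charPair_entries]
    exact (ρ γ).det_ne_zero
  have key : ∀ f : Mat → ℂ, (∀ A, f (entries A) = A.adjugate i j) →
      RegOn (pairSet n) (fun x => f (F x)) →
      matrixCoeff (HopfLinkGroup n) 2 γ⁻¹ i j ∈
        (regular (pairSet n)).map (pull (repPair hn)) := by
    intro f hf hreg
    have hreg' : RegOn (pairSet n) fun x => f (F x) / (charPair (F x)).2 :=
      hreg.div (by fun_prop) hdet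
    refine ⟨_, regOn_iff.mp hreg', funext fun ρ => ?_⟩
    change f (F (repPair hn ρ).1) / (charPair (F (repPair hn ρ).1)).2 = _
    rw [hγ, hf, charPair_entries, matrixCoeff, map_inv, Matrix.coe_units_inv, Matrix.inv_def,
      Matrix.smul_apply, Ring.inverse_eq_inv', smul_eq_mul, div_eq_inv_mul]
  fin_cases i <;> fin_cases j
  · exact key (fun A => A.2.2.2) (fun A => by simp [entries, Matrix.adjugate_fin_two])
      (by fun_prop)
  · exact key (fun A => -A.2.1) (fun A => by simp [entries, Matrix.adjugate_fin_two])
      (by fun_prop)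
  · exact key (fun A => -A.2.2.1) (fun A => by simp [entries, Matrix.adjugate_fin_two])
      (by fun_prop)
  · exact key (fun A => A.1) (fun A => by simp [entries, Matrix.adjugate_fin_two])
      (by fun_prop)

end

/-- For ≤, denominators without zeros are invertible in the coordinate ring, since it is affine. For
≥, the entries of the two generators and of their inverses suffice. -/
theorem map_pull_regular : (regular (pairSet n)).map (pull (repPair hn)) =
    repCoordinateRing (HopfLinkGroup n) 2 := by
  apply le_antisymm
  · rintro _ ⟨h, ⟨p, hp, q, hq, H⟩, rfl⟩
    have : pull (repPair hn) h = (fun ρ => p (repPair hn ρ).1) *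
        fun ρ => (q (repPair hn ρ).1)⁻¹ := by
      funext ρ
      exact (H (repPair hn ρ)).2.trans (div_eq_mul_inv _ _)
    change pull (repPair hn) h ∈ _
    rw [this]
    exact mul_mem (pull_poly_mem hn hp) ((isAffineRing_repCoordinateRing _ 2).inv_mem
      (pull_poly_mem hn hq) fun ρ => (H (repPair hn ρ)).1)
  · rw [repCoordinateRing_eq 2 (Set.range PresentedGroup.of)
      (PresentedGroup.closure_range_of _)]
    refine Algebra.adjoin_le ?_
    rintro _ ⟨_, ⟨k, rfl⟩, i, j, h⟩
    have hk : ∃ F : Mat × Mat → Mat, RegOn (pairSet n) F ∧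
        ∀ ρ, F (repPair hn ρ).1 = entries (ρ (PresentedGroup.of k)) := by
      fin_cases k
      · exact ⟨fun x => x.1, by fun_prop, fun _ => rfl⟩
      · exact ⟨fun x => x.2, by fun_prop, fun _ => rfl⟩
    obtain ⟨F, hF, hFρ⟩ := hk
    rcases h with rfl | rfl
    · exact matrixCoeff_mem hn F hF _ hFρ i j
    · exact matrixCoeff_inv_mem hn F hF _ hFρ i j

include hn in
/-- The motive of the representation variety is the class of the set of pairs of matrices. -/
theorem motive_hopfRepVariety : motive (hopfRepVariety n 2) = cls (pairSet n) := by
  have hA := isAffine_pairSet n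
  have := hA.finiteType
  have hinj : Function.Injective ((pull (repPair hn)).comp (regular (pairSet n)).val) := by
    intro f g hfg
    refine Subtype.ext (funext fun x => ?_)
    obtain ⟨ρ, rfl⟩ := repPair_surjective hn x
    exact congrFun hfg ρ
  rw [cls_eq_motive hA]
  refine (motive_affineVariety_congr ((AlgEquiv.ofInjective _ hinj).trans
    (Subalgebra.equivOfEq _ _ ?_))).symm
  rw [AlgHom.range_comp, Subalgebra.range_val, map_pull_regular hn]

end

end TwistedHopf

theorem mainTheorem3 (n : ℕ) (hn : 1 ≤ n) :
    TwistedHopf.motive (TwistedHopf.hopfRepVariety n 2) =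
      TwistedHopf.lefschetz * (TwistedHopf.lefschetz + 1) * (TwistedHopf.lefschetz - 1) ^ 3 *
        (((n / 2 : ℕ) : TwistedHopf.GrothendieckRing) * TwistedHopf.lefschetz ^ 2 +
          ((n : TwistedHopf.GrothendieckRing) - ((n / 2 : ℕ) : TwistedHopf.GrothendieckRing)) *
            TwistedHopf.lefschetz -
          ((n / 2 : ℕ) : TwistedHopf.GrothendieckRing) + 1) :=
  (TwistedHopf.motive_hopfRepVariety hn).trans (TwistedHopf.cls_pairSet hn)
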